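/- Proposition 4.14 (Characterisation of double central extensions). Let $\mathcal A$ be a semi-abelian category (pointed, Barr exact, protomodular, with binary coproducts), and let $$\begin{array}{ccc} X & \xrightarrow{\;c\;} & C\\ {\scriptstyle d}\downarrow & & \downarrow{\scriptstyle g}\\ D & \xrightarrow{\;f\;} & Z\end{array}$$ be a double extension in $\mathcal A$, that is, a pushout square all of whose arrows are regular epimorphisms. Write $K=\mathrm{Ker}(c)$ and $L=\mathrm{Ker}(d)$, as subobjects of $X$. Then the double extension is central if and only if $$[K,L,X]=[K,L]=[K\wedge L,X]=0.$$ Here the following definitions are used. Commutators. The co-smash product $X_1\otimes\cdots\otimes X_n$ ($n\ge 2$) is the kernel of the morphism $\coprod_{k}X_k\to\prod_{m}\coprod_{j\ne m}X_j$ whose $m$-th component is zero on the summand $X_m$ and is the coproduct inclusion on each summand $X_l$, $l\neq m$. For subobjects $x_i\colon X_i\to X$ ($1\le i\le n$), the commutator $[X_1,\dots,X_n]$ is the subobject of $X$ given by the image of the composite $X_1\otimes\cdots\otimes X_n\to X_1+\cdots+X_n\to X$, where the second morphism is induced by $x_1,\dots,x_n$. Centrality. Suppose given a category, a class of its morphisms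 called extensions, and a reflective full subcategory. An extension $u\colon A\to B$ is trivial if its naturality square with respect to the units $A\to IA$ and $B\to IB$ of the reflection is a pullback; it is central if there is an extension $p\colon E\to B$ such that the pullback of $u$ along $p$ exists and is a trivial extension. In $\mathcal A$, the extensions are the regular epimorphisms, and they are considered with respect to the abelian objects: those $A$ carrying a morphism $m\colon A\times A\times A\to A$ with $m(x,x,z)=z$ and $m(x,z,z)=x$. This yields the central extensions of $\mathcal A$. In the category of extensions of $\mathcal A$ (the full subcategory of the arrow category on the regular epimorphisms), the extensions are the double extensions, and they are considered with respect to the full subcategory of central extensions of $\mathcal A$. The double extension above is central if it is so in this sense, as the morphism $(c,f)\colon d\to g$. -/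

import Mathlib

open CategoryTheory CategoryTheory.Limits

universe v u

/-- A semi-abelian category: pointed, Barr exact (regular, with effective equivalence relations),
protomodular, with binary coproducts. -/
class SemiAbelian (C : Type u) [Category.{v} C] [HasZeroMorphisms C] : Prop extends
    Regular C, HasZeroObject C, HasBinaryCoproducts C where
  /-- Every internal equivalence relation is the kernel pair of some morphism. -/
  exact : ∀ {R X : C} (p₁ p₂ : R ⟶ X), IsEquivalenceRelation p₁ p₂ →
    ∃ (Y : C) (f : X ⟶ Y), IsKernelPair f p₁ p₂
  /-- Protomodularity, as the Split Short Five Lemma: in a morphism of split epimorphisms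
  (with chosen sections), if the map on codomains and the map on kernels are isomorphisms,
  then so is the map on domains. -/
  splitShortFive : ∀ {X' G' X G : C} (p' : X' ⟶ G') (s' : G' ⟶ X') (p : X ⟶ G) (s : G ⟶ X)
    (x : X' ⟶ X) (g : G' ⟶ G), s' ≫ p' = 𝟙 G' → s ≫ p = 𝟙 G →
    ∀ (hp : p' ≫ g = x ≫ p), s' ≫ x = g ≫ s →
    IsIso (kernel.map p' p x g hp) → IsIso g → IsIso x

instance SemiAbelian.instHasFiniteCoproducts (C : Type u) [Category.{v} C] [HasZeroMorphisms C]
    [SemiAbelian C] : HasFiniteCoproducts C :=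
  hasFiniteCoproducts_of_has_binary_and_initial

section Commutators

variable {C : Type u} [Category.{v} C] [HasZeroMorphisms C] [SemiAbelian C]

/-- The comparison morphism `r : ∐ₖ Xₖ ⟶ ∏ₘ ∐_{j ≠ m} Xⱼ`, whose `m`-th component kills the
summand `Xₘ` and is the coproduct inclusion on every other summand. -/
noncomputable def coSmashComparison {n : ℕ} (X : Fin n → C) :
    (∐ X) ⟶ ∏ᶜ fun m : Fin n => ∐ fun j : {j : Fin n // j ≠ m} => X j :=
  Pi.lift fun m => Sigma.desc fun l =>
    if h : l = m then 0 else Sigma.ι (fun j : {j : Fin n // j ≠ m} => X j) ⟨l, h⟩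

/-- The co-smash product `X₁ ⊗ ⋯ ⊗ Xₙ`. -/
noncomputable def coSmash {n : ℕ} (X : Fin n → C) : C :=
  kernel (coSmashComparison X)

/-- The canonical inclusion `X₁ ⊗ ⋯ ⊗ Xₙ ⟶ X₁ + ⋯ + Xₙ`. -/
noncomputable def coSmashι {n : ℕ} (X : Fin n → C) : coSmash X ⟶ ∐ X :=
  kernel.ι (coSmashComparison X)

/-- The (Higgins) commutator `[S₁, …, Sₙ]` of subobjects of `X`: the image of
`S₁ ⊗ ⋯ ⊗ Sₙ ⟶ S₁ + ⋯ + Sₙ ⟶ X`. -/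
noncomputable def commutatorSubobject {X : C} {n : ℕ} (S : Fin n → Subobject X) : Subobject X :=
  imageSubobject (coSmashι (fun i => (S i : C)) ≫ Sigma.desc fun i => (S i).arrow)

end Commutators

section Galois

variable {E : Type u} [Category.{v} E]

/-- `η : A ⟶ A'` is a reflection of `A` into the full subcategory of objects satisfying `P`. -/
def IsReflectionInto (P : ObjectProperty E) {A A' : E} (η : A ⟶ A') : Prop :=
  P A' ∧ ∀ ⦃Y : E⦄, P Y → ∀ f : A ⟶ Y, ∃! g : A' ⟶ Y, η ≫ g = f

/-- Given a class `W` of extensions and a (reflective) full subcategory `P`, an extension is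
*trivial* when its naturality square with respect to the unit of the reflection is a pullback. -/
def IsTrivialExtension (W : MorphismProperty E) (P : ObjectProperty E) {A B : E} (f : A ⟶ B) :
    Prop :=
  W f ∧ ∃ (A' B' : E) (ηA : A ⟶ A') (ηB : B ⟶ B') (f' : A' ⟶ B'),
    IsReflectionInto P ηA ∧ IsReflectionInto P ηB ∧ IsPullback f ηA ηB f'

/-- An extension is *central* (with respect to `P`) when it is locally trivial: its pullback along
some extension is a trivial extension. -/
def IsCentralExtension (W : MorphismProperty E) (P : ObjectProperty E) {A B : E} (f : A ⟶ B) :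
    Prop :=
  W f ∧ ∃ (A₁ B₁ : E) (q : A₁ ⟶ A) (f₁ : A₁ ⟶ B₁) (p : B₁ ⟶ B),
    W p ∧ IsPullback q f₁ f p ∧ IsTrivialExtension W P f₁

end Galois

section Extensions

variable (C : Type u) [Category.{v} C]

/-- Abelian objects: those carrying an internal Mal'tsev operation `g : X × X × X ⟶ X`,
that is, `g(x, x, z) = z` and `g(x, z, z) = x`. -/
def abelianObjects [HasBinaryProducts C] : ObjectProperty C := fun X =>
  ∃ g : (X ⨯ X) ⨯ X ⟶ X,
    prod.lift (prod.lift prod.fst prod.fst) prod.snd ≫ g = (prod.snd : X ⨯ X ⟶ X) ∧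
    prod.lift (prod.lift prod.fst prod.snd) prod.snd ≫ g = (prod.fst : X ⨯ X ⟶ X)

/-- The category of extensions: the full subcategory of the arrow category on the regular
epimorphisms. -/
abbrev ExtensionCat : Type (max u v) :=
  ObjectProperty.FullSubcategory (C := Arrow C) fun a => IsRegularEpi a.hom

variable {C}

/-- A double extension: a pushout square
```
X --c--> C₀
|        |
d        g
v        v
D --f--> Z
```
all of whose arrows are regular epimorphisms. -/
structure IsDoubleExtension {X C₀ D Z : C} (c : X ⟶ C₀) (d : X ⟶ D) (g : C₀ ⟶ Z) (f : D ⟶ Z) :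
    Prop where
  isPushout : IsPushout c d g f
  regularEpi_c : IsRegularEpi c
  regularEpi_d : IsRegularEpi d
  regularEpi_g : IsRegularEpi g
  regularEpi_f : IsRegularEpi f

variable (C) in
/-- Double extensions, as a class of morphisms of the category of extensions. -/
def doubleExtensions : MorphismProperty (ExtensionCat C) := fun a b φ =>
  IsDoubleExtension φ.hom.left a.obj.hom b.obj.hom φ.hom.right

variable (C) in
/-- The central extensions (with respect to the abelian objects), as a full subcategory of the
category of extensions. -/
def centralExtensions [HasBinaryProducts C] : ObjectProperty (ExtensionCat C) := fun a =>
  IsCentralExtension (MorphismProperty.regularEpi C) (abelianObjects C) a.obj.hom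

namespace IsDoubleExtension

variable {X C₀ D Z : C} {c : X ⟶ C₀} {d : X ⟶ D} {g : C₀ ⟶ Z} {f : D ⟶ Z}

/-- A double extension viewed as the morphism `(c, f) : d ⟶ g` between extensions. -/
def toHom (h : IsDoubleExtension c d g f) :
    (⟨Arrow.mk d, h.regularEpi_d⟩ : ExtensionCat C) ⟶ ⟨Arrow.mk g, h.regularEpi_g⟩ :=
  ObjectProperty.homMk (Arrow.homMk c f h.isPushout.w)

/-- A double extension is central when, as a morphism of the category of extensions, it is central
with respect to the full subcategory of central extensions, double extensions playing the role of
extensions. -/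
def IsCentral [HasBinaryProducts C] (h : IsDoubleExtension c d g f) : Prop :=
  IsCentralExtension (doubleExtensions C) (centralExtensions C) h.toHom

end IsDoubleExtension

end Extensions

/-! The argument uses generalised elements, taken up to precomposition with strong epimorphisms. A
commutator vanishes when every element of the co-smash product is sent to 0. `Comm₂` and `Comm₃` say
this for arbitrary morphisms and may be checked after covering the variables by strong epimorphisms.

One level down, an extension of domain `A` is central exactly when the commutator of its kernel with
`A` vanishes (`isCentralExtension_iff`). Hence the reflection of `d` into central extensions is
X/[L,X] → D (`exists_central_reflection`). In a trivial double extension, an element of [kernel,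
domain] is 0 once its image in the codomain is 0 (`eq_zero_of_isTrivialExtension_double`).

Necessity (`comm_of_isCentral`): let the pullback along some double extension be trivial, with top
object P over X. K embeds in P with zero image in the codomain, and L lifts locally to the kernel of
the pulled-back extension. With K absorbed into P, elements of [K,L,X] and [K,L] lift to elements of
[kernel, P] with zero image, hence vanish. K∧L itself lifts to the kernel with zero image, which
handles [K∧L,X].

Sufficiency (`isCentral_of_comm`): pull the double extension back along itself. The top object is
the kernel pair R of `c`, generated by K×0 and the diagonal of X. The kernel L₁ of R → D×_Z D is
generated by (K∧L)×0 and the diagonal of L. Expanding [L₁,R] over these joins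
(`IsCross₂.desc_desc_eq`), every non-diagonal contribution lies in [K∧L,X], [K,L] or [K,L,X]. So
[L₁,R] lies in the diagonal: it meets the kernel of the second projection trivially, and it maps
onto [L,X]. This makes the naturality square a pullback (`isPullback_of_quotients`). -/

namespace SemiAbelian

attribute [local simp] coprod.inl_desc coprod.inl_desc_assoc coprod.inr_desc coprod.inr_desc_assoc
  prod.lift_fst prod.lift_fst_assoc prod.lift_snd prod.lift_snd_assoc
  pullback.lift_fst pullback.lift_fst_assoc pullback.lift_snd pullback.lift_snd_assoc
  equalizer.lift_ι equalizer.lift_ι_assoc Sigma.ι_desc Sigma.ι_desc_assoc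
  Pi.lift_π Pi.lift_π_assoc

/-! ### Local lifting of generalised elements and consequences of protomodularity. -/

section

section Local

variable {C : Type u} [Category.{v} C]

theorem strongEpi_of_local_section {X Y S : C} {f : X ⟶ Y} {e : S ⟶ Y} {x : S ⟶ X} [StrongEpi e]
    (h : x ≫ f = e) : StrongEpi f := by
  subst h
  exact strongEpi_of_strongEpi x f

theorem factors_of_local {S S' I Y : C} {e : S' ⟶ S} [StrongEpi e] {w : S ⟶ Y} {m : I ⟶ Y} [Mono m]
    {u : S' ⟶ I} (h : u ≫ m = e ≫ w) : ∃ w' : S ⟶ I, w' ≫ m = w :=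
  ⟨(CommSq.mk h).lift, (CommSq.mk h).fac_right⟩

end Local

section Regular

variable {C : Type u} [Category.{v} C] [Regular C]

theorem isRegularEpi_iff_strongEpi {X Y : C} (f : X ⟶ Y) : IsRegularEpi f ↔ StrongEpi f :=
  ⟨fun _ => inferInstance, fun _ => inferInstance⟩

theorem strongEpi_of_isPullback {P X Y Z : C} {fst : P ⟶ X} {snd : P ⟶ Y} {f : X ⟶ Z} {g : Y ⟶ Z}
    (h : IsPullback fst snd f g) [StrongEpi f] : StrongEpi snd := by
  rw [← isRegularEpi_iff_strongEpi]
  exact Regular.regularEpiIsStableUnderBaseChange.of_isPullback h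
    ((isRegularEpi_iff_strongEpi f).2 inferInstance)

/-- Generalised elements lift locally along strong epimorphisms. -/
theorem exists_local_lift {X Y S : C} (f : X ⟶ Y) [StrongEpi f] (y : S ⟶ Y) :
    ∃ (S' : C) (e : S' ⟶ S) (x : S' ⟶ X), StrongEpi e ∧ x ≫ f = e ≫ y :=
  ⟨pullback f y, pullback.snd f y, pullback.fst f y,
    strongEpi_of_isPullback (IsPullback.of_hasPullback f y), pullback.condition⟩

theorem exists_image_factorisation {X Y : C} (f : X ⟶ Y) :
    ∃ (I : C) (e : X ⟶ I) (m : I ⟶ Y), StrongEpi e ∧ Mono m ∧ e ≫ m = f :=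
  ⟨_, factorThruImage f, image.ι f, inferInstance, inferInstance, image.fac f⟩

theorem strongEpi_of_extremal {X Y : C} (f : X ⟶ Y)
    (h : ∀ ⦃Z : C⦄ (p : X ⟶ Z) (m : Z ⟶ Y) [Mono m], p ≫ m = f → ∃ s, s ≫ m = 𝟙 Y) :
    StrongEpi f := by
  rw [← extremalEpi_iff_strongEpi_of_hasPullbacks]
  refine ExtremalEpi.mk_of_hasEqualizers f fun Z p m hm _ => ?_
  obtain ⟨s, hs⟩ := h p m hm
  exact ⟨s, by rw [← cancel_mono m]; simp [hs], hs⟩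

theorem strongEpi_coprod_desc [HasBinaryCoproducts C] {A B Y : C} {a : A ⟶ Y} {b : B ⟶ Y}
    (h : ∀ ⦃Z : C⦄ (m : Z ⟶ Y) [Mono m], (∃ a', a' ≫ m = a) → (∃ b', b' ≫ m = b) →
      ∃ s, s ≫ m = 𝟙 Y) : StrongEpi (coprod.desc a b) :=
  strongEpi_of_extremal _ fun Z p m _ hm =>
    h m ⟨coprod.inl ≫ p, by simp [hm]⟩ ⟨coprod.inr ≫ p, by simp [hm]⟩

theorem strongEpi_coprod_map [HasBinaryCoproducts C] {A A' B B' : C} (a : A ⟶ A') (b : B ⟶ B')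
    [StrongEpi a] [StrongEpi b] : StrongEpi (coprod.map a b) := by
  have : coprod.map a b = coprod.desc (a ≫ coprod.inl) (b ≫ coprod.inr) := by
    ext <;> simp
  rw [this]
  refine strongEpi_coprod_desc ?_
  rintro Z m _ ⟨a', ha⟩ ⟨b', hb⟩
  obtain ⟨u, hu⟩ := factors_of_local ha
  obtain ⟨v, hv⟩ := factors_of_local hb
  exact ⟨coprod.desc u v, by ext <;> simp [hu, hv]⟩

theorem exists_splitting {T : C} {e : T ⟶ T} (he : e ≫ e = e) :
    ∃ (Y : C) (p : T ⟶ Y) (s : Y ⟶ T), s ≫ p = 𝟙 Y ∧ p ≫ s = e := by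
  refine ⟨equalizer e (𝟙 T), equalizer.lift e (by simp [he]), equalizer.ι e (𝟙 T), ?_, by simp⟩
  ext
  simpa using equalizer.condition e (𝟙 T)

end Regular

variable {C : Type u} [Category.{v} C] [HasZeroMorphisms C] [SemiAbelian C]

/-- A monomorphism through which the kernel and the image of an idempotent factor is split epi. -/
theorem exists_section_of_idempotent {I T : C} (m : I ⟶ T) [Mono m] {e : T ⟶ T} (he : e ≫ e = e)
    (h₁ : ∃ e', e' ≫ m = e) (h₂ : ∀ ⦃S : C⦄ (w : S ⟶ T), w ≫ e = 0 → ∃ w', w' ≫ m = w) :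
    ∃ s, s ≫ m = 𝟙 T := by
  obtain ⟨Y, p, s, hs, hp⟩ := exists_splitting he
  obtain ⟨e', he'⟩ := h₁
  have hse : s ≫ e' ≫ m = s := by rw [he', ← hp, ← Category.assoc, hs, Category.id_comp]
  have h₃ : kernel.ι p ≫ e = 0 := by rw [← hp, kernel.condition_assoc, zero_comp]
  obtain ⟨k', hk'⟩ := h₂ _ h₃
  have hk : k' ≫ m ≫ p = 0 := by rw [← Category.assoc, hk', kernel.condition]
  have hiso : IsIso (kernel.map (m ≫ p) p m (𝟙 Y) (by simp)) := by
    refine ⟨kernel.lift _ k' hk, ?_, ?_⟩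
    · rw [← cancel_mono (kernel.ι (m ≫ p)), ← cancel_mono m]
      simp [hk']
    · rw [← cancel_mono (kernel.ι p)]
      simp [hk']
  have : IsIso m := SemiAbelian.splitShortFive (m ≫ p) (s ≫ e') p s m (𝟙 Y)
    (by simp only [Category.assoc] at hse ⊢; rw [reassoc_of% hse, hs]) hs (by simp) (by simp [hse])
    hiso inferInstance
  exact ⟨inv m, by simp⟩

theorem hom_ext_of_idempotent {T Y : C} {e : T ⟶ T} (he : e ≫ e = e) {φ ψ : T ⟶ Y}
    (h₁ : e ≫ φ = e ≫ ψ) (h₂ : ∀ ⦃S : C⦄ (w : S ⟶ T), w ≫ e = 0 → w ≫ φ = w ≫ ψ) : φ = ψ := by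
  obtain ⟨s, hs⟩ := exists_section_of_idempotent (equalizer.ι φ ψ) he
    ⟨equalizer.lift e h₁, by simp⟩ fun S w hw => ⟨equalizer.lift w (h₂ w hw), by simp⟩
  rw [← Category.id_comp φ, ← Category.id_comp ψ, ← hs, Category.assoc, Category.assoc,
    equalizer.condition]

theorem mono_of_kernel_trivial {X Y : C} (f : X ⟶ Y)
    (h : ∀ ⦃S : C⦄ (w : S ⟶ X), w ≫ f = 0 → w = 0) : Mono f := by
  suffices hR : pullback.fst f f = pullback.snd f f by
    constructor
    intro Z a b hab
    rw [← pullback.lift_fst (f := f) (g := f) a b hab, hR, pullback.lift_snd]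
  refine hom_ext_of_idempotent (e := pullback.fst f f ≫ pullback.lift (𝟙 X) (𝟙 X) rfl)
    (by simp) (by simp) fun S w hw => ?_
  have h₁ : w ≫ pullback.fst f f = 0 := by simpa using hw =≫ pullback.fst f f
  have h₂ : w ≫ pullback.snd f f = 0 :=
    h _ (by rw [Category.assoc, ← pullback.condition, ← Category.assoc, h₁, zero_comp])
  rw [h₁, h₂]

/-- A strong epimorphism is the cokernel of its kernel. -/
theorem exists_desc {X Y Z : C} (f : X ⟶ Y) [StrongEpi f] (g : X ⟶ Z)
    (h : ∀ ⦃S : C⦄ (w : S ⟶ X), w ≫ f = 0 → w ≫ g = 0) : ∃ k : Y ⟶ Z, f ≫ k = g := by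
  have := (isRegularEpi_iff_strongEpi f).2 inferInstance
  suffices hR : pullback.fst f f ≫ g = pullback.snd f f ≫ g by
    refine ⟨IsRegularEpi.desc f g ?_, IsRegularEpi.fac f g _⟩
    have := pullback.lift (IsRegularEpi.left f) (IsRegularEpi.right f) (IsRegularEpi.w f) ≫= hR
    simpa using this
  refine hom_ext_of_idempotent (e := pullback.fst f f ≫ pullback.lift (𝟙 X) (𝟙 X) rfl)
    (by simp) (by simp) fun S w hw => ?_
  have h₁ : w ≫ pullback.fst f f = 0 := by simpa using hw =≫ pullback.fst f f
  have h₂ : (w ≫ pullback.snd f f) ≫ g = 0 :=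
    h _ (by rw [Category.assoc, ← pullback.condition, ← Category.assoc, h₁, zero_comp])
  rw [← Category.assoc, h₁, zero_comp, ← Category.assoc, h₂]

/-- Non-split form of `exists_section_of_idempotent`: base change along `m ≫ p` splits `p`, and the
conclusion descends along the resulting strong epimorphism. -/
theorem exists_section_of_comp_strongEpi {I J T : C} (m : I ⟶ J) [Mono m] (p : J ⟶ T)
    [StrongEpi (m ≫ p)] (h : ∀ ⦃S : C⦄ (w : S ⟶ J), w ≫ p = 0 → ∃ w', w' ≫ m = w) :
    ∃ s, s ≫ m = 𝟙 J := by
  let Q := pullback p (m ≫ p)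
  let e : Q ⟶ Q := pullback.lift (pullback.snd p (m ≫ p) ≫ m) (pullback.snd p (m ≫ p)) (by simp)
  obtain ⟨s, hs⟩ := exists_section_of_idempotent (pullback.snd m (pullback.fst p (m ≫ p)))
    (e := e) (by ext <;> simp [e])
    ⟨pullback.lift (pullback.snd p (m ≫ p)) e (by simp [e]), by simp⟩ (by
      intro S w hw
      have h₁ : w ≫ pullback.snd p (m ≫ p) = 0 := by simpa [e] using hw =≫ pullback.snd p (m ≫ p)
      obtain ⟨w', hw'⟩ := h (w ≫ pullback.fst p (m ≫ p))
        (by rw [Category.assoc, pullback.condition, ← Category.assoc, h₁, zero_comp])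
      exact ⟨pullback.lift w' w hw', by simp⟩)
  have := strongEpi_of_isPullback (IsPullback.of_hasPullback p (m ≫ p)).flip
  have hfac : (s ≫ pullback.fst m (pullback.fst p (m ≫ p))) ≫ m = pullback.fst p (m ≫ p) ≫ 𝟙 J := by
    rw [Category.assoc, pullback.condition, ← Category.assoc, hs]
    simp
  exact factors_of_local hfac

/-- A subobject of the pullback through which `X` factors covers `E`, and by `h` it contains the
kernel of the projection to `E`, which is the kernel of `f`. -/
theorem strongEpi_pullback_lift {X D E Z : C} {c : X ⟶ E} {d : X ⟶ D} {g : E ⟶ Z} {f : D ⟶ Z}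
    (w : c ≫ g = d ≫ f) [StrongEpi c]
    (h : ∀ ⦃S : C⦄ (y : S ⟶ D), y ≫ f = 0 → ∃ (S' : C) (e : S' ⟶ S) (x : S' ⟶ X),
      StrongEpi e ∧ x ≫ c = 0 ∧ x ≫ d = e ≫ y) : StrongEpi (pullback.lift c d w) := by
  refine strongEpi_of_extremal _ fun I p m _ hm => ?_
  have h₁ : p ≫ m ≫ pullback.fst g f = c := by rw [← Category.assoc, hm, pullback.lift_fst]
  have : StrongEpi (m ≫ pullback.fst g f) := strongEpi_of_local_section h₁
  refine exists_section_of_comp_strongEpi m (pullback.fst g f) fun S y hy => ?_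
  obtain ⟨S', e, x, _, hx₁, hx₂⟩ := h (y ≫ pullback.snd g f)
    (by rw [Category.assoc, ← pullback.condition, ← Category.assoc, hy, zero_comp])
  refine factors_of_local (e := e) (u := x ≫ p) ?_
  rw [Category.assoc, hm]
  ext
  · simp [hx₁, hy]
  · simp [hx₂]

theorem exists_local_lift_of_square {X D E Z : C} {c : X ⟶ E} {d : X ⟶ D} {g : E ⟶ Z} {f : D ⟶ Z}
    (w : c ≫ g = d ≫ f) [StrongEpi c]
    (h : ∀ ⦃S : C⦄ (y : S ⟶ D), y ≫ f = 0 → ∃ (S' : C) (e : S' ⟶ S) (x : S' ⟶ X),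
      StrongEpi e ∧ x ≫ c = 0 ∧ x ≫ d = e ≫ y) {S : C} (z : S ⟶ E) (y : S ⟶ D)
    (hzy : z ≫ g = y ≫ f) :
    ∃ (S' : C) (e : S' ⟶ S) (x : S' ⟶ X), StrongEpi e ∧ x ≫ c = e ≫ z ∧ x ≫ d = e ≫ y := by
  have := strongEpi_pullback_lift w h
  obtain ⟨S', e, x, he, hx⟩ := exists_local_lift (pullback.lift c d w) (pullback.lift z y hzy)
  exact ⟨S', e, x, he, by simpa using hx =≫ pullback.fst g f, by simpa using hx =≫ pullback.snd g f⟩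

/-- Idempotents stand for split epimorphisms. After splitting, the section carries the kernel of the
induced map on images into the kernel of `q`, so `T` covers the pullback and the pair `(w, 0)`
lifts. -/
theorem exists_local_lift_kernel {T T' S : C} (q : T ⟶ T') [StrongEpi q] {e : T ⟶ T} {e' : T' ⟶ T'}
    (he : e ≫ e = e) (hq : e ≫ q = q ≫ e') (w : S ⟶ T') (hw : w ≫ e' = 0) :
    ∃ (S' : C) (c : S' ⟶ S) (x : S' ⟶ T), StrongEpi c ∧ x ≫ e = 0 ∧ x ≫ q = c ≫ w := by
  have he' : e' ≫ e' = e' := by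
    rw [← cancel_epi q, ← Category.assoc, ← hq, Category.assoc, ← hq, reassoc_of% he]
  obtain ⟨Y, p, s, hs, rfl⟩ := exists_splitting he
  obtain ⟨Y', p', s', hs', rfl⟩ := exists_splitting he'
  have hqp : q ≫ p' = p ≫ s ≫ q ≫ p' := by
    have := hq =≫ p'
    simp only [Category.assoc, hs', Category.comp_id] at this
    exact this.symm
  obtain ⟨S', c, x, hc, hx₁, hx₂⟩ := exists_local_lift_of_square (c := q) (d := p) (g := p')
    (f := s ≫ q ≫ p') hqp (fun R y hy => ⟨R, 𝟙 R, y ≫ s, inferInstance, by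
      have h₁ : s ≫ q = (s ≫ q ≫ p') ≫ s' := by
        have := s ≫= hq
        simpa [reassoc_of% hs] using this
      rw [Category.assoc, h₁, ← Category.assoc, hy, zero_comp], by simp [hs]⟩) w 0
    (by
      have := hw =≫ p'
      simpa [hs'] using this)
  exact ⟨S', c, x, hc, by rw [← Category.assoc, hx₂]; simp, hx₁⟩

/-- Since the idempotents commute, `e₂` restricts to the kernel of `e₁`, where `q` is still a strong
epimorphism; the one-idempotent case applies again. -/
theorem exists_local_lift_kernel₂ {T T' S : C} (q : T ⟶ T') [StrongEpi q] {e₁ e₂ : T ⟶ T}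
    {e₁' e₂' : T' ⟶ T'} (he₁ : e₁ ≫ e₁ = e₁) (he₂ : e₂ ≫ e₂ = e₂) (h₁₂ : e₁ ≫ e₂ = e₂ ≫ e₁)
    (hq₁ : e₁ ≫ q = q ≫ e₁') (hq₂ : e₂ ≫ q = q ≫ e₂') (w : S ⟶ T') (hw₁ : w ≫ e₁' = 0)
    (hw₂ : w ≫ e₂' = 0) :
    ∃ (S' : C) (c : S' ⟶ S) (x : S' ⟶ T),
      StrongEpi c ∧ x ≫ e₁ = 0 ∧ x ≫ e₂ = 0 ∧ x ≫ q = c ≫ w := by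
  have h₁₂' : e₁' ≫ e₂' = e₂' ≫ e₁' := by
    rw [← cancel_epi q, ← Category.assoc, ← hq₁, Category.assoc, ← hq₂, reassoc_of% h₁₂, hq₁,
      reassoc_of% hq₂]
  have : StrongEpi (kernel.map e₁ e₁' q q hq₁) := by
    obtain ⟨S', c, x, hc, hx₁, hx₂⟩ := exists_local_lift_kernel q he₁ hq₁ (kernel.ι e₁')
      (kernel.condition e₁')
    refine strongEpi_of_local_section (e := c) (x := kernel.lift e₁ x hx₁) ?_
    ext
    simp [hx₂]
  obtain ⟨S', c, x, hc, hx₁, hx₂⟩ := exists_local_lift_kernel (kernel.map e₁ e₁' q q hq₁)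
    (e := kernel.map e₁ e₁ e₂ e₂ h₁₂) (e' := kernel.map e₁' e₁' e₂' e₂' h₁₂')
    (by ext; simp [he₂]) (by ext; simp [hq₂]) (kernel.lift e₁' w hw₁) (by ext; simp [hw₂])
  refine ⟨S', c, x ≫ kernel.ι e₁, hc, by simp, ?_, ?_⟩
  · simpa using hx₁ =≫ kernel.ι e₁
  · simpa using hx₂ =≫ kernel.ι e₁'

theorem exists_local_lift_kernel₃ {T T' S : C} (q : T ⟶ T') [StrongEpi q] {e₁ e₂ e₃ : T ⟶ T}
    {e₁' e₂' e₃' : T' ⟶ T'} (he₁ : e₁ ≫ e₁ = e₁) (he₂ : e₂ ≫ e₂ = e₂) (he₃ : e₃ ≫ e₃ = e₃)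
    (h₁₂ : e₁ ≫ e₂ = e₂ ≫ e₁) (h₁₃ : e₁ ≫ e₃ = e₃ ≫ e₁) (h₂₃ : e₂ ≫ e₃ = e₃ ≫ e₂)
    (hq₁ : e₁ ≫ q = q ≫ e₁') (hq₂ : e₂ ≫ q = q ≫ e₂') (hq₃ : e₃ ≫ q = q ≫ e₃') (w : S ⟶ T')
    (hw₁ : w ≫ e₁' = 0) (hw₂ : w ≫ e₂' = 0) (hw₃ : w ≫ e₃' = 0) :
    ∃ (S' : C) (c : S' ⟶ S) (x : S' ⟶ T),
      StrongEpi c ∧ x ≫ e₁ = 0 ∧ x ≫ e₂ = 0 ∧ x ≫ e₃ = 0 ∧ x ≫ q = c ≫ w := by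
  have h₁₂' : e₁' ≫ e₂' = e₂' ≫ e₁' := by
    rw [← cancel_epi q, ← Category.assoc, ← hq₁, Category.assoc, ← hq₂, reassoc_of% h₁₂, hq₁,
      reassoc_of% hq₂]
  have h₁₃' : e₁' ≫ e₃' = e₃' ≫ e₁' := by
    rw [← cancel_epi q, ← Category.assoc, ← hq₁, Category.assoc, ← hq₃, reassoc_of% h₁₃, hq₁,
      reassoc_of% hq₃]
  have : StrongEpi (kernel.map e₁ e₁' q q hq₁) := by
    obtain ⟨S', c, x, hc, hx₁, hx₂⟩ := exists_local_lift_kernel q he₁ hq₁ (kernel.ι e₁')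
      (kernel.condition e₁')
    refine strongEpi_of_local_section (e := c) (x := kernel.lift e₁ x hx₁) ?_
    ext
    simp [hx₂]
  obtain ⟨S', c, x, hc, hx₁, hx₂, hx₃⟩ := exists_local_lift_kernel₂ (kernel.map e₁ e₁' q q hq₁)
    (e₁ := kernel.map e₁ e₁ e₂ e₂ h₁₂) (e₁' := kernel.map e₁' e₁' e₂' e₂' h₁₂')
    (e₂ := kernel.map e₁ e₁ e₃ e₃ h₁₃) (e₂' := kernel.map e₁' e₁' e₃' e₃' h₁₃')
    (by ext; simp [he₂]) (by ext; simp [he₃]) (by ext; simp [h₂₃]) (by ext; simp [hq₂])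
    (by ext; simp [hq₃]) (kernel.lift e₁' w hw₁) (by ext; simp [hw₂]) (by ext; simp [hw₃])
  refine ⟨S', c, x ≫ kernel.ι e₁, hc, by simp, ?_, ?_, ?_⟩
  · simpa using hx₁ =≫ kernel.ι e₁
  · simpa using hx₂ =≫ kernel.ι e₁
  · simpa using hx₃ =≫ kernel.ι e₁'

end

/-! ### The Mal'tsev property, cokernels and normal images. -/

section

variable {C : Type u} [Category.{v} C] [HasZeroMorphisms C] [SemiAbelian C]

/-- Every relation in a semi-abelian category is difunctional. -/
theorem exists_difunctional {R X Y : C} (r₁ : R ⟶ X) (r₂ : R ⟶ Y) [Mono (prod.lift r₁ r₂)] {S : C}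
    (a b c : S ⟶ R) (hab : a ≫ r₂ = b ≫ r₂) (hbc : b ≫ r₁ = c ≫ r₁) :
    ∃ d : S ⟶ R, d ≫ r₁ = a ≫ r₁ ∧ d ≫ r₂ = c ≫ r₂ := by
  -- `J` is the object of zigzags (α, β, γ), and `e` sends such a triple to (α, β, β). The required
  -- element is α on the image of `e` and γ on its kernel, where α and β vanish.
  let J := pullback (pullback.snd r₂ r₂ ≫ r₁) r₁
  let α : J ⟶ R := pullback.fst _ _ ≫ pullback.fst r₂ r₂
  let β : J ⟶ R := pullback.fst _ _ ≫ pullback.snd r₂ r₂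
  let γ : J ⟶ R := pullback.snd _ _
  have hαβ : α ≫ r₂ = β ≫ r₂ := by simp [α, β, pullback.condition]
  have hβγ : β ≫ r₁ = γ ≫ r₁ := by simp [β, γ, ← pullback.condition]
  let e : J ⟶ J := pullback.lift (pullback.fst _ _) β (by simp [β])
  have heα : e ≫ α = α := by simp [e, α]
  have heβ : e ≫ β = β := by simp [e, β]
  have heγ : e ≫ γ = β := by simp [e, γ]
  have hJ : ∀ {T : C} (f g : T ⟶ J), f ≫ α = g ≫ α → f ≫ β = g ≫ β → f ≫ γ = g ≫ γ → f = g := by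
    intro T f g h₁ h₂ h₃
    refine pullback.hom_ext (pullback.hom_ext ?_ ?_) h₃
    · simpa [α] using h₁
    · simpa [β] using h₂
  obtain ⟨s, hs⟩ := exists_section_of_idempotent
    (pullback.snd (prod.lift r₁ r₂) (prod.lift (α ≫ r₁) (γ ≫ r₂))) (e := e)
    (hJ _ _ (by simp [heα]) (by simp [heβ]) (by simp [heγ, heβ]))
    ⟨pullback.lift α e (by ext <;> simp [reassoc_of% heα, reassoc_of% heγ, hαβ]), by simp⟩ (by
      intro T w hw
      have h₁ : w ≫ α = 0 := by rw [← heα, ← Category.assoc, hw, zero_comp]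
      have h₂ : w ≫ β = 0 := by rw [← heβ, ← Category.assoc, hw, zero_comp]
      have h₃ : w ≫ γ ≫ r₁ = 0 := by rw [← hβγ, ← Category.assoc, h₂, zero_comp]
      exact ⟨pullback.lift (w ≫ γ) w (by ext <;> simp [h₃, reassoc_of% h₁]), by simp⟩)
  have hd := s ≫= pullback.condition (f := prod.lift r₁ r₂) (g := prod.lift (α ≫ r₁) (γ ≫ r₂))
  rw [reassoc_of% hs] at hd
  let j : S ⟶ J := pullback.lift (pullback.lift a b hab) c (by simp [hbc])
  refine ⟨j ≫ s ≫ pullback.fst _ _, ?_, ?_⟩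
  · have := j ≫= (hd =≫ prod.fst)
    simpa [j, α] using this
  · have := j ≫= (hd =≫ prod.snd)
    simpa [j, γ] using this

/-- Symmetry and transitivity come from difunctionality applied to zigzags through reflexive pairs.
-/
theorem isEquivalenceRelation_of_reflexive {R X : C} (r₁ r₂ : R ⟶ X) [Mono (prod.lift r₁ r₂)]
    (r : X ⟶ R) (h₁ : r ≫ r₁ = 𝟙 X) (h₂ : r ≫ r₂ = 𝟙 X) : IsEquivalenceRelation r₁ r₂ := by
  have hs := exists_difunctional r₁ r₂ (r₂ ≫ r) (𝟙 R) (r₁ ≫ r) (by simp [h₂]) (by simp [h₁])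
  have ht := exists_difunctional r₁ r₂ (pullback.fst r₂ r₁) (pullback.snd r₂ r₁ ≫ r₁ ≫ r)
    (pullback.snd r₂ r₁) (by simp [h₂, pullback.condition]) (by simp [h₁])
  exact ⟨⟨
    { right_cancellation := fun Y f g hf hg => by
        rw [← cancel_mono (prod.lift r₁ r₂)]
        ext <;> simpa
      r := r
      reflexivity₁ := h₁
      reflexivity₂ := h₂
      s := hs.choose
      symmetry₁ := by simpa [h₁] using hs.choose_spec.1
      symmetry₂ := by simpa [h₂] using hs.choose_spec.2
      c := _
      isLimit := limit.isLimit (cospan r₂ r₁)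
      t := ht.choose
      transitivity₁ := ht.choose_spec.1
      transitivity₂ := ht.choose_spec.2 }⟩⟩

/-- A cokernel of `a`, together with a description of the normal closure of the image of `a`. -/
theorem exists_cokernel {A X : C} (a : A ⟶ X) :
    ∃ (Q : C) (q : X ⟶ Q), StrongEpi q ∧ a ≫ q = 0 ∧ ∀ ⦃S : C⦄ (w : S ⟶ X), w ≫ q = 0 →
      ∃ (S' : C) (e : S' ⟶ S) (u : S' ⟶ A ⨿ X), StrongEpi e ∧ u ≫ coprod.desc 0 (𝟙 X) = 0 ∧
        u ≫ coprod.desc a (𝟙 X) = e ≫ w := by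
  -- This image is a reflexive relation, hence effective; it identifies 0 with `a`, and the elements
  -- related to 0 form the normal closure.
  obtain ⟨R, ε, m, _, _, hm⟩ := exists_image_factorisation
    (prod.lift (coprod.desc 0 (𝟙 X)) (coprod.desc a (𝟙 X)))
  have h₁ : ε ≫ m ≫ prod.fst = coprod.desc 0 (𝟙 X) := by rw [← Category.assoc, hm]; simp
  have h₂ : ε ≫ m ≫ prod.snd = coprod.desc a (𝟙 X) := by rw [← Category.assoc, hm]; simp
  have hmono : prod.lift (m ≫ prod.fst) (m ≫ prod.snd) = m := by ext <;> simp
  have : Mono (prod.lift (m ≫ prod.fst) (m ≫ prod.snd)) := by rwa [hmono]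
  obtain ⟨Y, f, hf⟩ := SemiAbelian.exact _ _ (isEquivalenceRelation_of_reflexive (m ≫ prod.fst)
    (m ≫ prod.snd) (coprod.inr ≫ ε) (by simp [h₁]) (by simp [h₂]))
  obtain ⟨Q, q, n, hq, _, rfl⟩ := exists_image_factorisation f
  refine ⟨Q, q, hq, ?_, fun S w hw => ?_⟩
  · have := (coprod.inl ≫ ε) ≫= hf.w
    rw [← cancel_mono n]
    simp only [Category.assoc] at this ⊢
    rw [reassoc_of% h₁, reassoc_of% h₂] at this
    simpa using this.symm
  · have hz : (0 : S ⟶ X) ≫ q ≫ n = w ≫ q ≫ n := by rw [← Category.assoc w, hw]; simp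
    obtain ⟨S', e, u, he, hu⟩ := exists_local_lift ε (hf.lift 0 w hz)
    refine ⟨S', e, u, he, ?_, ?_⟩
    · rw [← h₁, reassoc_of% hu]
      have := hf.lift_fst 0 w hz
      rw [this, comp_zero]
    · rw [← h₂, reassoc_of% hu]
      have := hf.lift_snd 0 w hz
      rw [this]

/-- The image of `a` is a normal subobject. -/
def HasNormalImage {A X : C} (a : A ⟶ X) : Prop :=
  ∀ ⦃S : C⦄ (u : S ⟶ A ⨿ X), u ≫ coprod.desc 0 (𝟙 X) = 0 →
    ∃ (S' : C) (e : S' ⟶ S) (v : S' ⟶ A), StrongEpi e ∧ v ≫ a = e ≫ u ≫ coprod.desc a (𝟙 X)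

theorem HasNormalImage.exists_cokernel {A X : C} {a : A ⟶ X} (ha : HasNormalImage a) :
    ∃ (Q : C) (q : X ⟶ Q), StrongEpi q ∧ a ≫ q = 0 ∧ ∀ ⦃S : C⦄ (w : S ⟶ X), w ≫ q = 0 →
      ∃ (S' : C) (e : S' ⟶ S) (v : S' ⟶ A), StrongEpi e ∧ v ≫ a = e ≫ w := by
  obtain ⟨Q, q, hq, haq, h⟩ := SemiAbelian.exists_cokernel a
  refine ⟨Q, q, hq, haq, fun S w hw => ?_⟩
  obtain ⟨S', e, u, _, hu₁, hu₂⟩ := h w hw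
  obtain ⟨S'', e', v, _, hv⟩ := ha u hu₁
  exact ⟨S'', e' ≫ e, v, inferInstance, by rw [hv, hu₂, Category.assoc]⟩

theorem hasNormalImage_kernel {X Y : C} (f : X ⟶ Y) : HasNormalImage (kernel.ι f) := by
  intro S u hu
  have : coprod.desc (kernel.ι f) (𝟙 X) ≫ f = coprod.desc 0 (𝟙 X) ≫ f := by ext <;> simp
  exact ⟨S, 𝟙 S, kernel.lift f (u ≫ coprod.desc (kernel.ι f) (𝟙 X))
    (by rw [Category.assoc, this, ← Category.assoc, hu, zero_comp]), inferInstance, by simp⟩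

theorem HasNormalImage.comp {A X Y : C} {a : A ⟶ X} (ha : HasNormalImage a) (q : X ⟶ Y)
    [StrongEpi q] : HasNormalImage (a ≫ q) := by
  intro S u hu
  have := strongEpi_coprod_map (𝟙 A) q
  obtain ⟨S', e, x, _, hx₁, hx₂⟩ := exists_local_lift_kernel (coprod.map (𝟙 A) q)
    (e := coprod.desc (0 : A ⟶ A ⨿ X) coprod.inr) (e' := coprod.desc (0 : A ⟶ A ⨿ Y) coprod.inr)
    (by ext <;> simp) (by ext <;> simp) u (by
      have : coprod.desc (0 : A ⟶ A ⨿ Y) coprod.inr = coprod.desc 0 (𝟙 Y) ≫ coprod.inr := by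
        ext <;> simp
      rw [this, ← Category.assoc, hu, zero_comp])
  obtain ⟨S'', e', v, _, hv⟩ := ha x (by
    have : coprod.desc (0 : A ⟶ X) (𝟙 X) =
        coprod.desc (0 : A ⟶ A ⨿ X) coprod.inr ≫ coprod.desc 0 (𝟙 X) := by
      ext <;> simp
    rw [this, ← Category.assoc, hx₁, zero_comp])
  refine ⟨S'', e' ≫ e, v, inferInstance, ?_⟩
  have : coprod.desc a (𝟙 X) ≫ q = coprod.map (𝟙 A) q ≫ coprod.desc (a ≫ q) (𝟙 Y) := by
    ext <;> simp
  rw [← Category.assoc, hv, Category.assoc, Category.assoc, this, reassoc_of% hx₂]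
  simp

end

/-! ### Cross elements and the calculus of commutators. -/

section

theorem comp_eq_zero_of_factor {C : Type u} [Category.{v} C] [HasZeroMorphisms C] {S T U V : C}
    {w : S ⟶ T} {p : T ⟶ U} {f : T ⟶ V} (h : w ≫ p = 0)
    (q : U ⟶ V) (hq : p ≫ q = f) : w ≫ f = 0 := by
  rw [← hq, ← Category.assoc, h, zero_comp]

variable {C : Type u} [Category.{v} C] [HasZeroMorphisms C] [SemiAbelian C]

/-- `w` is a generalised element of the binary co-smash product `A ⊗ B`. -/
structure IsCross₂ {S A B : C} (w : S ⟶ A ⨿ B) : Prop where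
  left : w ≫ coprod.desc (𝟙 A) 0 = 0
  right : w ≫ coprod.desc 0 (𝟙 B) = 0

/-- `w` is a generalised element of the ternary co-smash product `A ⊗ B ⊗ D`. -/
structure IsCross₃ {S A B D : C} (w : S ⟶ (A ⨿ B) ⨿ D) : Prop where
  kill₁ : w ≫ coprod.map (coprod.desc 0 (𝟙 B)) (𝟙 D) = 0
  kill₂ : w ≫ coprod.map (coprod.desc (𝟙 A) 0) (𝟙 D) = 0
  kill₃ : w ≫ coprod.desc (𝟙 (A ⨿ B)) 0 = 0

/-- The commutator of the images of `x` and `y` is trivial. -/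
def Comm₂ {A B X : C} (x : A ⟶ X) (y : B ⟶ X) : Prop :=
  ∀ ⦃S : C⦄ (w : S ⟶ A ⨿ B), IsCross₂ w → w ≫ coprod.desc x y = 0

/-- The ternary commutator of the images of `x`, `y` and `z` is trivial. -/
def Comm₃ {A B D X : C} (x : A ⟶ X) (y : B ⟶ X) (z : D ⟶ X) : Prop :=
  ∀ ⦃S : C⦄ (w : S ⟶ (A ⨿ B) ⨿ D), IsCross₃ w → w ≫ coprod.desc (coprod.desc x y) z = 0

theorem IsCross₂.map {S A B A' B' : C} {w : S ⟶ A ⨿ B} (hw : IsCross₂ w) (a : A ⟶ A')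
    (b : B ⟶ B') : IsCross₂ (w ≫ coprod.map a b) where
  left := by
    rw [Category.assoc]
    exact comp_eq_zero_of_factor hw.left a (by ext <;> simp)
  right := by
    rw [Category.assoc]
    exact comp_eq_zero_of_factor hw.right b (by ext <;> simp)

theorem IsCross₂.swap {S A B : C} {w : S ⟶ A ⨿ B} (hw : IsCross₂ w) :
    IsCross₂ (w ≫ coprod.desc coprod.inr coprod.inl) where
  left := by
    rw [Category.assoc]
    exact comp_eq_zero_of_factor hw.right (𝟙 B) (by ext <;> simp)
  right := by
    rw [Category.assoc]
    exact comp_eq_zero_of_factor hw.left (𝟙 A) (by ext <;> simp)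

/-- Folding the first and the third variable of a ternary co-smash product. -/
theorem IsCross₃.fold {S A B D : C} {w : S ⟶ (A ⨿ B) ⨿ D} (hw : IsCross₃ w) (a : A ⟶ D) :
    IsCross₂ (w ≫ coprod.desc (coprod.desc (a ≫ coprod.inr) coprod.inl) coprod.inr) where
  left := by
    rw [Category.assoc]
    exact comp_eq_zero_of_factor hw.kill₃ (coprod.desc 0 (𝟙 B)) (by ext <;> simp)
  right := by
    rw [Category.assoc]
    exact comp_eq_zero_of_factor hw.kill₂ (coprod.desc a (𝟙 D)) (by ext <;> simp)

/-- Cross elements form the common kernel of two commuting idempotents of the coproduct, each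
erasing one summand. -/
theorem IsCross₂.exists_local_lift {S A B A' B' : C} (a : A ⟶ A') (b : B ⟶ B') [StrongEpi a]
    [StrongEpi b] {w : S ⟶ A' ⨿ B'} (hw : IsCross₂ w) :
    ∃ (S' : C) (e : S' ⟶ S) (w' : S' ⟶ A ⨿ B), StrongEpi e ∧ IsCross₂ w' ∧
      w' ≫ coprod.map a b = e ≫ w := by
  have := strongEpi_coprod_map a b
  obtain ⟨S', e, x, he, hx₁, hx₂, hx₃⟩ := exists_local_lift_kernel₂ (coprod.map a b)
    (e₁ := coprod.map (𝟙 A) 0) (e₂ := coprod.map 0 (𝟙 B)) (e₁' := coprod.map (𝟙 A') 0)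
    (e₂' := coprod.map 0 (𝟙 B')) (by ext <;> simp) (by ext <;> simp) (by ext <;> simp)
    (by ext <;> simp) (by ext <;> simp) w
    (comp_eq_zero_of_factor hw.left coprod.inl (by ext <;> simp))
    (comp_eq_zero_of_factor hw.right coprod.inr (by ext <;> simp))
  exact ⟨S', e, x, he,
    ⟨comp_eq_zero_of_factor hx₁ (coprod.desc (𝟙 A) 0) (by ext <;> simp),
      comp_eq_zero_of_factor hx₂ (coprod.desc 0 (𝟙 B)) (by ext <;> simp)⟩, hx₃⟩

theorem IsCross₃.exists_local_lift {S A B D A' B' D' : C} (a : A ⟶ A') (b : B ⟶ B') (d : D ⟶ D')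
    [StrongEpi a] [StrongEpi b] [StrongEpi d] {w : S ⟶ (A' ⨿ B') ⨿ D'} (hw : IsCross₃ w) :
    ∃ (S' : C) (e : S' ⟶ S) (w' : S' ⟶ (A ⨿ B) ⨿ D), StrongEpi e ∧ IsCross₃ w' ∧
      w' ≫ coprod.map (coprod.map a b) d = e ≫ w := by
  have := strongEpi_coprod_map a b
  have := strongEpi_coprod_map (coprod.map a b) d
  obtain ⟨S', e, x, he, hx₁, hx₂, hx₃, hx⟩ :=
    exists_local_lift_kernel₃ (coprod.map (coprod.map a b) d)
    (e₁ := coprod.map (coprod.map 0 (𝟙 B)) (𝟙 D)) (e₂ := coprod.map (coprod.map (𝟙 A) 0) (𝟙 D))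
    (e₃ := coprod.map (𝟙 (A ⨿ B)) 0) (e₁' := coprod.map (coprod.map 0 (𝟙 B')) (𝟙 D'))
    (e₂' := coprod.map (coprod.map (𝟙 A') 0) (𝟙 D')) (e₃' := coprod.map (𝟙 (A' ⨿ B')) 0)
    (by ext <;> simp) (by ext <;> simp) (by ext <;> simp)
    (by ext <;> simp) (by ext <;> simp) (by ext <;> simp)
    (by ext <;> simp) (by ext <;> simp) (by ext <;> simp) w
    (comp_eq_zero_of_factor hw.kill₁ (coprod.map coprod.inr (𝟙 D')) (by ext <;> simp))
    (comp_eq_zero_of_factor hw.kill₂ (coprod.map coprod.inl (𝟙 D')) (by ext <;> simp))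
    (comp_eq_zero_of_factor hw.kill₃ coprod.inl (by ext <;> simp))
  exact ⟨S', e, x, he,
    ⟨comp_eq_zero_of_factor hx₁ (coprod.map (coprod.desc 0 (𝟙 B)) (𝟙 D)) (by ext <;> simp),
      comp_eq_zero_of_factor hx₂ (coprod.map (coprod.desc (𝟙 A) 0) (𝟙 D)) (by ext <;> simp),
      comp_eq_zero_of_factor hx₃ (coprod.desc (𝟙 (A ⨿ B)) 0) (by ext <;> simp)⟩, hx⟩

theorem Comm₂.symm {A B X : C} {x : A ⟶ X} {y : B ⟶ X} (h : Comm₂ x y) : Comm₂ y x := by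
  intro S w hw
  have : coprod.desc y x = coprod.desc coprod.inr coprod.inl ≫ coprod.desc x y := by
    ext <;> simp
  rw [this, ← Category.assoc]
  exact h _ hw.swap

theorem Comm₂.precomp {A B A' B' X : C} {x : A ⟶ X} {y : B ⟶ X} (h : Comm₂ x y) (a : A' ⟶ A)
    (b : B' ⟶ B) : Comm₂ (a ≫ x) (b ≫ y) := by
  intro S w hw
  rw [← coprod.map_desc, ← Category.assoc]
  exact h _ (hw.map a b)

theorem Comm₃.precomp {A B D A' B' D' X : C} {x : A ⟶ X} {y : B ⟶ X} {z : D ⟶ X}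
    (h : Comm₃ x y z) (a : A' ⟶ A) (b : B' ⟶ B) (d : D' ⟶ D) :
    Comm₃ (a ≫ x) (b ≫ y) (d ≫ z) := by
  intro S w hw
  have h₁ : coprod.desc (coprod.desc (a ≫ x) (b ≫ y)) (d ≫ z) =
    coprod.map (coprod.map a b) d ≫ coprod.desc (coprod.desc x y) z := by ext <;> simp
  rw [h₁, ← Category.assoc]
  refine h _ ⟨?_, ?_, ?_⟩ <;> rw [Category.assoc]
  · exact comp_eq_zero_of_factor hw.kill₁ (coprod.map b d) (by ext <;> simp)
  · exact comp_eq_zero_of_factor hw.kill₂ (coprod.map a d) (by ext <;> simp)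
  · exact comp_eq_zero_of_factor hw.kill₃ (coprod.map a b) (by ext <;> simp)

theorem Comm₂.of_strongEpi {A B A' B' X : C} {x : A ⟶ X} {y : B ⟶ X} (a : A' ⟶ A) (b : B' ⟶ B)
    [StrongEpi a] [StrongEpi b] (h : Comm₂ (a ≫ x) (b ≫ y)) : Comm₂ x y := by
  intro S w hw
  obtain ⟨S', e, w', _, hw', he⟩ := hw.exists_local_lift a b
  have := h w' hw'
  rw [← coprod.map_desc, ← Category.assoc, he, Category.assoc] at this
  rwa [← cancel_epi e, comp_zero]

theorem Comm₃.of_strongEpi {A B D A' B' D' X : C} {x : A ⟶ X} {y : B ⟶ X} {z : D ⟶ X}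
    (a : A' ⟶ A) (b : B' ⟶ B) (d : D' ⟶ D) [StrongEpi a] [StrongEpi b] [StrongEpi d]
    (h : Comm₃ (a ≫ x) (b ≫ y) (d ≫ z)) : Comm₃ x y z := by
  intro S w hw
  obtain ⟨S', e, w', _, hw', he⟩ := hw.exists_local_lift a b d
  have := h w' hw'
  rw [← coprod.map_desc, ← coprod.map_desc, ← Category.assoc, he, Category.assoc] at this
  rwa [← cancel_epi e, comp_zero]

/-- A repeated variable can be folded away, leaving a binary cross element. -/
theorem comm₃_of_comm₂ {A B D X : C} {y : B ⟶ X} {z : D ⟶ X} (a : A ⟶ D) (h : Comm₂ y z) :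
    Comm₃ (a ≫ z) y z := by
  intro S w hw
  have : coprod.desc (coprod.desc (a ≫ z) y) z =
      coprod.desc (coprod.desc (a ≫ coprod.inr) coprod.inl) coprod.inr ≫ coprod.desc y z := by
    ext <;> simp
  rw [this, ← Category.assoc]
  exact h _ (hw.fold a)

theorem IsCross₂.desc_zero_left {S A B X : C} {w : S ⟶ A ⨿ B} (hw : IsCross₂ w) (y : B ⟶ X) :
    w ≫ coprod.desc 0 y = 0 :=
  comp_eq_zero_of_factor hw.right y (by ext <;> simp)

/-- Morphisms on the kernel of `f` agree when they do so on the kernel and on the image of an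
idempotent which restricts to the kernel of `f`. -/
theorem eq_on_kernel_of_idempotent {T T' Y : C} {f : T ⟶ T'} {e : T ⟶ T} (he : e ≫ e = e)
    (g : T' ⟶ T') (hg : e ≫ f = f ≫ g) {φ ψ : T ⟶ Y}
    (h₁ : ∀ ⦃S : C⦄ (w : S ⟶ T), w ≫ f = 0 → w ≫ e = 0 → w ≫ φ = w ≫ ψ)
    (h₂ : ∀ ⦃S : C⦄ (w : S ⟶ T), w ≫ f = 0 → w ≫ e ≫ φ = w ≫ e ≫ ψ) ⦃S : C⦄ (w : S ⟶ T)
    (hw : w ≫ f = 0) : w ≫ φ = w ≫ ψ := by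
  suffices h : kernel.ι f ≫ φ = kernel.ι f ≫ ψ by
    rw [← kernel.lift_ι f w hw, Category.assoc, h, Category.assoc]
  refine hom_ext_of_idempotent (e := kernel.map f f e g hg.symm) (by ext; simp [he]) ?_ ?_
  · simpa using h₂ (kernel.ι f) (kernel.condition f)
  · intro R v hv
    simpa using h₁ (v ≫ kernel.ι f) (by simp) (by simpa using hv =≫ kernel.ι f)

/-- The join decomposition of the commutator `[A ∨ L, K ∨ X]`, in the form needed for central
extensions. -/
theorem IsCross₂.desc_desc_eq {A L K X S : C} {a : A ⟶ X} {l : L ⟶ X} {k : K ⟶ X}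
    (ha : Comm₂ a (𝟙 X)) (hl : Comm₂ l k) (hlk : Comm₃ l k (𝟙 X))
    {w : S ⟶ (A ⨿ L) ⨿ (K ⨿ X)} (hw : IsCross₂ w) :
    w ≫ coprod.desc (coprod.desc a l) (coprod.desc k (𝟙 X)) =
      w ≫ coprod.desc (coprod.desc 0 l) (coprod.desc 0 (𝟙 X)) := by
  let T := (A ⨿ L) ⨿ (K ⨿ X)
  let f : T ⟶ (A ⨿ L) ⨯ (K ⨿ X) :=
    prod.lift (coprod.desc (𝟙 (A ⨿ L)) 0) (coprod.desc 0 (𝟙 (K ⨿ X)))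
  let eA : A ⨿ L ⟶ A ⨿ L := coprod.map 0 (𝟙 L)
  let eK : K ⨿ X ⟶ K ⨿ X := coprod.map 0 (𝟙 X)
  let eX : K ⨿ X ⟶ K ⨿ X := coprod.map (𝟙 K) 0
  have hA : eA ≫ eA = eA := by ext <;> simp [eA]
  have hK : eK ≫ eK = eK := by ext <;> simp [eK]
  have hX : eX ≫ eX = eX := by ext <;> simp [eX]
  have hXK : eX ≫ eK = eK ≫ eX := by ext <;> simp [eX, eK]
  have cross : ∀ {R : C} {w : R ⟶ T}, w ≫ f = 0 → IsCross₂ w := fun {R w} h =>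
    ⟨by simpa [f] using h =≫ prod.fst, by simpa [f] using h =≫ prod.snd⟩
  refine eq_on_kernel_of_idempotent (f := f) (e := coprod.map eA (𝟙 _)) (by ext <;> simp [hA])
    (prod.map eA (𝟙 _)) (by ext <;> simp [f]) ?_ ?_ w
    (by ext <;> simp [f, hw.left, hw.right])
  -- On elements that die when `A` is erased, merging `L` and `K` into `X` gives cross elements of
  -- `A` and `X`, which `ha` kills. The other side does not see `A`, so it vanishes as well.
  · intro R w hw hwA
    have hw' := cross hw
    trans 0
    · let ρ : T ⟶ A ⨿ X := coprod.desc (coprod.desc coprod.inl (l ≫ coprod.inr))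
        (coprod.desc (k ≫ coprod.inr) coprod.inr)
      have hρ : ρ ≫ coprod.desc a (𝟙 X) = coprod.desc (coprod.desc a l) (coprod.desc k (𝟙 X)) := by
        ext <;> simp [ρ]
      rw [← hρ, ← Category.assoc]
      refine ha _ ⟨?_, ?_⟩ <;> rw [Category.assoc]
      · exact comp_eq_zero_of_factor hw'.left (coprod.desc (𝟙 A) 0) (by ext <;> simp [ρ])
      · exact comp_eq_zero_of_factor hwA (ρ ≫ coprod.desc 0 (𝟙 X)) (by ext <;> simp [ρ, eA])
    · exact (comp_eq_zero_of_factor hwA (coprod.desc (coprod.desc 0 l) (coprod.desc 0 (𝟙 X)))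
        (by ext <;> simp [eA])).symm
  -- With `A` erased, the same decomposition is applied to the idempotent erasing `K`.
  refine eq_on_kernel_of_idempotent (f := f) (e := coprod.map (𝟙 _) eK) (by ext <;> simp [hK])
    (prod.map (𝟙 _) eK) (by ext <;> simp [f]) ?_ ?_
  · intro R w hw hwK
    trans w ≫ (0 : T ⟶ X)
    · refine eq_on_kernel_of_idempotent (f := prod.lift f (coprod.map (𝟙 _) eK))
        (e := coprod.map (𝟙 _) eX) (by ext <;> simp [hX])
        (prod.map (prod.map (𝟙 _) eX) (coprod.map (𝟙 _) eX)) (by ext <;> simp [f, hXK])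
        ?_ ?_ w (by ext <;> simp [hw, hwK])
      -- These elements die when any one of `L`, `K`, `X` is erased, so they are ternary cross
      -- elements and `hlk` applies.
      · intro R w hw hwX
        have hwK : w ≫ coprod.map (𝟙 _) eK = 0 := by simpa using hw =≫ prod.snd
        have hw' := cross (by simpa using hw =≫ prod.fst)
        let ρ : T ⟶ (L ⨿ K) ⨿ X := coprod.desc (coprod.desc 0 (coprod.inl ≫ coprod.inl))
          (coprod.desc (coprod.inr ≫ coprod.inl) coprod.inr)
        have hρ : ρ ≫ coprod.desc (coprod.desc l k) (𝟙 X) = coprod.map eA (𝟙 _) ≫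
            coprod.desc (coprod.desc a l) (coprod.desc k (𝟙 X)) := by
          ext <;> simp [ρ, eA]
        rw [← hρ, comp_zero, ← Category.assoc]
        refine hlk _ ⟨?_, ?_, ?_⟩ <;> rw [Category.assoc]
        · exact comp_eq_zero_of_factor hw'.right (𝟙 (K ⨿ X)) (by ext <;> simp [ρ])
        · exact comp_eq_zero_of_factor hwK (ρ ≫ coprod.map (coprod.desc (𝟙 L) 0) (𝟙 X))
            (by ext <;> simp [ρ, eK])
        · exact comp_eq_zero_of_factor hwX (ρ ≫ coprod.desc (𝟙 (L ⨿ K)) 0)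
            (by ext <;> simp [ρ, eX])
      -- With `X` erased too, only `L` and `K` remain, and `hl` applies.
      · intro R w hw
        have hw' := cross (by simpa using hw =≫ prod.fst)
        let ρ : T ⟶ L ⨿ K := coprod.desc (coprod.desc 0 coprod.inl) (coprod.desc coprod.inr 0)
        have hρ : ρ ≫ coprod.desc l k = coprod.map (𝟙 _) eX ≫ coprod.map eA (𝟙 _) ≫
            coprod.desc (coprod.desc a l) (coprod.desc k (𝟙 X)) := by
          ext <;> simp [ρ, eA, eX]
        rw [← hρ, comp_zero, comp_zero, ← Category.assoc]
        refine hl _ ⟨?_, ?_⟩ <;> rw [Category.assoc]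
        · exact comp_eq_zero_of_factor hw'.left (coprod.desc 0 (𝟙 L)) (by ext <;> simp [ρ])
        · exact comp_eq_zero_of_factor hw'.right (coprod.desc (𝟙 K) 0) (by ext <;> simp [ρ])
    · rw [comp_zero]
      exact (comp_eq_zero_of_factor hwK (coprod.map eA (𝟙 _) ≫
        coprod.desc (coprod.desc 0 l) (coprod.desc 0 (𝟙 X))) (by ext <;> simp [eA, eK])).symm
  -- With `A` and `K` both erased, the two morphisms coincide.
  · intro R w hw
    congr 1
    ext <;> simp [eA, eK]

end

/-! ### Commutators of subobjects in terms of cross elements; abelian objects. -/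

section

variable {C : Type u} [Category.{v} C] [HasZeroMorphisms C] [SemiAbelian C]

/-- Each component of the comparison is universal among the morphisms killing its summand.
Quantifying over all of these removes the coproducts over subtypes. -/
theorem comp_coSmashComparison_eq_zero_iff {n : ℕ} (F : Fin n → C) {R : C} (w : R ⟶ ∐ F) :
    w ≫ coSmashComparison F = 0 ↔
      ∀ (m : Fin n) ⦃Y : C⦄ (g : ∐ F ⟶ Y), Sigma.ι F m ≫ g = 0 → w ≫ g = 0 := by
  constructor
  · intro h m Y g hg
    have hm := h =≫ Pi.π _ m
    simp only [coSmashComparison, Category.assoc, Pi.lift_π, zero_comp] at hm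
    refine comp_eq_zero_of_factor hm (Sigma.desc fun j => Sigma.ι F j ≫ g) ?_
    refine Sigma.hom_ext _ _ fun l => ?_
    rw [Sigma.ι_desc_assoc]
    split_ifs with hl
    · subst hl
      rw [hg, zero_comp]
    · simp
  · intro h
    refine Pi.hom_ext _ _ fun m => ?_
    simp only [coSmashComparison, Category.assoc, Pi.lift_π, zero_comp]
    exact h m _ (by simp)

theorem imageSubobject_eq_bot_iff {X Y : C} (f : X ⟶ Y) : imageSubobject f = ⊥ ↔ f = 0 := by
  constructor
  · intro h
    rw [← Subobject.bot_factors_iff_zero, ← h, ← imageSubobject_arrow_comp f]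
    simpa using Subobject.factors_comp_arrow (factorThruImageSubobject f)
  · rintro rfl
    exact imageSubobject_zero

theorem commutatorSubobject_eq_bot_iff {X : C} {n : ℕ} (S : Fin n → Subobject X) :
    commutatorSubobject S = ⊥ ↔ ∀ ⦃R : C⦄ (w : R ⟶ ∐ fun i => (S i : C)),
      (∀ (m : Fin n) ⦃Y : C⦄ (g : (∐ fun i => (S i : C)) ⟶ Y),
        Sigma.ι (fun i => (S i : C)) m ≫ g = 0 → w ≫ g = 0) →
      w ≫ Sigma.desc (fun i => (S i).arrow) = 0 := by
  have h₁ : commutatorSubobject S = ⊥ ↔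
      coSmashι (fun i => (S i : C)) ≫ Sigma.desc (fun i => (S i).arrow) = 0 :=
    imageSubobject_eq_bot_iff _
  rw [h₁]
  constructor
  · intro h R w hw
    rw [← kernel.lift_ι _ w ((comp_coSmashComparison_eq_zero_iff _ w).2 hw), Category.assoc]
    erw [h, comp_zero]
  · intro h
    exact h _ ((comp_coSmashComparison_eq_zero_iff _ _).1 (kernel.condition _))

theorem comm₂_iff_sigma {X : C} (F : Fin 2 → C) (x : ∀ i, F i ⟶ X) :
    (∀ ⦃R : C⦄ (w : R ⟶ ∐ F), (∀ (m : Fin 2) ⦃Y : C⦄ (g : ∐ F ⟶ Y),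
      Sigma.ι F m ≫ g = 0 → w ≫ g = 0) → w ≫ Sigma.desc x = 0) ↔ Comm₂ (x 0) (x 1) := by
  constructor
  · intro h R w hw
    have : coprod.desc (x 0) (x 1) =
        coprod.desc (Sigma.ι F 0) (Sigma.ι F 1) ≫ Sigma.desc x := by ext <;> simp
    rw [this, ← Category.assoc]
    refine h _ fun m Y g hg => ?_
    rw [Category.assoc]
    fin_cases m
    · exact comp_eq_zero_of_factor hw.right (Sigma.ι F 1 ≫ g) (by
        ext
        · simpa using hg.symm
        · simp)
    · exact comp_eq_zero_of_factor hw.left (Sigma.ι F 0 ≫ g) (by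
        ext
        · simp
        · simpa using hg.symm)
  · intro h R w hw
    let σ : ∐ F ⟶ F 0 ⨿ F 1 := Sigma.desc fun i => match i with
      | 0 => coprod.inl
      | 1 => coprod.inr
    have h₀ : Sigma.ι F 0 ≫ σ = coprod.inl := Sigma.ι_desc _ _
    have h₁ : Sigma.ι F 1 ≫ σ = coprod.inr := Sigma.ι_desc _ _
    have : Sigma.desc x = σ ≫ coprod.desc (x 0) (x 1) := by
      refine Sigma.hom_ext _ _ fun i => ?_
      rw [Sigma.ι_desc]
      fin_cases i
      · exact (by rw [reassoc_of% h₀]; simp : x 0 = Sigma.ι F 0 ≫ σ ≫ coprod.desc (x 0) (x 1))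
      · exact (by rw [reassoc_of% h₁]; simp : x 1 = Sigma.ι F 1 ≫ σ ≫ coprod.desc (x 0) (x 1))
    rw [this, ← Category.assoc]
    refine h _ ⟨?_, ?_⟩ <;> rw [Category.assoc]
    · exact hw 1 _ (by rw [reassoc_of% h₁]; simp)
    · exact hw 0 _ (by rw [reassoc_of% h₀]; simp)

theorem comm₃_iff_sigma {X : C} (F : Fin 3 → C) (x : ∀ i, F i ⟶ X) :
    (∀ ⦃R : C⦄ (w : R ⟶ ∐ F), (∀ (m : Fin 3) ⦃Y : C⦄ (g : ∐ F ⟶ Y),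
      Sigma.ι F m ≫ g = 0 → w ≫ g = 0) → w ≫ Sigma.desc x = 0) ↔ Comm₃ (x 0) (x 1) (x 2) := by
  constructor
  · intro h R w hw
    let τ : (F 0 ⨿ F 1) ⨿ F 2 ⟶ ∐ F :=
      coprod.desc (coprod.desc (Sigma.ι F 0) (Sigma.ι F 1)) (Sigma.ι F 2)
    have : coprod.desc (coprod.desc (x 0) (x 1)) (x 2) = τ ≫ Sigma.desc x := by
      ext <;> simp [τ]
    rw [this, ← Category.assoc]
    refine h _ fun m Y g hg => ?_
    rw [Category.assoc]
    fin_cases m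
    · refine comp_eq_zero_of_factor hw.kill₁ (coprod.map coprod.inr (𝟙 _) ≫ τ ≫ g) ?_
      ext
      · simpa [τ] using hg.symm
      · simp [τ]
      · simp [τ]
    · refine comp_eq_zero_of_factor hw.kill₂ (coprod.map coprod.inl (𝟙 _) ≫ τ ≫ g) ?_
      ext
      · simp [τ]
      · simpa [τ] using hg.symm
      · simp [τ]
    · refine comp_eq_zero_of_factor hw.kill₃ (coprod.inl ≫ τ ≫ g) ?_
      ext
      · simp [τ]
      · simp [τ]
      · simpa [τ] using hg.symm
  · intro h R w hw
    let σ : ∐ F ⟶ (F 0 ⨿ F 1) ⨿ F 2 := Sigma.desc fun i => match i with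
      | 0 => coprod.inl ≫ coprod.inl
      | 1 => coprod.inr ≫ coprod.inl
      | 2 => coprod.inr
    have h₀ : Sigma.ι F 0 ≫ σ = coprod.inl ≫ coprod.inl := Sigma.ι_desc _ _
    have h₁ : Sigma.ι F 1 ≫ σ = coprod.inr ≫ coprod.inl := Sigma.ι_desc _ _
    have h₂ : Sigma.ι F 2 ≫ σ = coprod.inr := Sigma.ι_desc _ _
    have : Sigma.desc x = σ ≫ coprod.desc (coprod.desc (x 0) (x 1)) (x 2) := by
      refine Sigma.hom_ext _ _ fun i => ?_
      rw [Sigma.ι_desc]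
      fin_cases i
      · exact (by rw [reassoc_of% h₀]; simp : x 0 =
          Sigma.ι F 0 ≫ σ ≫ coprod.desc (coprod.desc (x 0) (x 1)) (x 2))
      · exact (by rw [reassoc_of% h₁]; simp : x 1 =
          Sigma.ι F 1 ≫ σ ≫ coprod.desc (coprod.desc (x 0) (x 1)) (x 2))
      · exact (by rw [reassoc_of% h₂]; simp : x 2 =
          Sigma.ι F 2 ≫ σ ≫ coprod.desc (coprod.desc (x 0) (x 1)) (x 2))
    rw [this, ← Category.assoc]
    refine h _ ⟨?_, ?_, ?_⟩ <;> rw [Category.assoc]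
    · exact hw 0 _ (by rw [reassoc_of% h₀]; simp)
    · exact hw 1 _ (by rw [reassoc_of% h₁]; simp)
    · exact hw 2 _ (by rw [reassoc_of% h₂]; simp)

theorem commutatorSubobject_pair_eq_bot_iff {X : C} (S₁ S₂ : Subobject X) :
    commutatorSubobject ![S₁, S₂] = ⊥ ↔ Comm₂ S₁.arrow S₂.arrow :=
  (commutatorSubobject_eq_bot_iff _).trans
    (comm₂_iff_sigma (fun i => (![S₁, S₂] i : C)) fun i => (![S₁, S₂] i).arrow)

theorem commutatorSubobject_triple_eq_bot_iff {X : C} (S₁ S₂ S₃ : Subobject X) :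
    commutatorSubobject ![S₁, S₂, S₃] = ⊥ ↔ Comm₃ S₁.arrow S₂.arrow S₃.arrow :=
  (commutatorSubobject_eq_bot_iff _).trans
    (comm₃_iff_sigma (fun i => (![S₁, S₂, S₃] i : C)) fun i => (![S₁, S₂, S₃] i).arrow)

/-- The operation m(x, 0, z) extends the codiagonal from Y + Y to Y × Y, so the codiagonal kills
cross elements. -/
theorem comm₂_id_of_abelian {Y : C} (hY : abelianObjects C Y) : Comm₂ (𝟙 Y) (𝟙 Y) := by
  obtain ⟨g, hg₁, hg₂⟩ := hY
  intro S w hw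
  have h₁ := prod.lift 0 (𝟙 Y) ≫= hg₁
  have h₂ := prod.lift (𝟙 Y) 0 ≫= hg₂
  simp only [prod.comp_lift_assoc, prod.lift_fst, prod.lift_snd, prod.comp_lift] at h₁ h₂
  refine comp_eq_zero_of_factor (p := coprod.desc (prod.lift (𝟙 Y) 0) (prod.lift 0 (𝟙 Y))) ?_
    (prod.lift (prod.lift prod.fst 0) prod.snd ≫ g) ?_
  · ext
    · rw [zero_comp, Category.assoc]
      exact comp_eq_zero_of_factor hw.left (𝟙 Y) (by ext <;> simp)
    · rw [zero_comp, Category.assoc]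
      exact comp_eq_zero_of_factor hw.right (𝟙 Y) (by ext <;> simp)
  · ext
    · simpa [prod.comp_lift_assoc] using h₂
    · simpa [prod.comp_lift_assoc] using h₁

/-- Y + Y → Y × Y is a strong epimorphism whose kernel consists of the cross elements, so the
codiagonal descends along it. -/
theorem exists_addition {Y : C} (h : Comm₂ (𝟙 Y) (𝟙 Y)) :
    ∃ μ : Y ⨯ Y ⟶ Y, prod.lift (𝟙 Y) 0 ≫ μ = 𝟙 Y ∧ prod.lift 0 (𝟙 Y) ≫ μ = 𝟙 Y := by
  have : StrongEpi (coprod.desc (prod.lift (𝟙 Y) 0) (prod.lift 0 (𝟙 Y))) := by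
    refine strongEpi_coprod_desc ?_
    rintro Z m _ ⟨a, ha⟩ ⟨b, hb⟩
    refine exists_section_of_idempotent m (e := prod.map 0 (𝟙 Y)) (by ext <;> simp)
      ⟨prod.snd ≫ b, by ext <;> simp [hb]⟩ fun S w hw => ⟨w ≫ prod.fst ≫ a, ?_⟩
    have : w ≫ prod.snd = 0 := by simpa using hw =≫ prod.snd
    ext <;> simp [ha, this]
  obtain ⟨μ, hμ⟩ := exists_desc (coprod.desc (prod.lift (𝟙 Y) 0) (prod.lift 0 (𝟙 Y)))
    (coprod.desc (𝟙 Y) (𝟙 Y)) fun S w hw => h w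
      ⟨comp_eq_zero_of_factor hw prod.fst (by ext <;> simp),
        comp_eq_zero_of_factor hw prod.snd (by ext <;> simp)⟩
  exact ⟨μ, by simpa using coprod.inl ≫= hμ, by simpa using coprod.inr ≫= hμ⟩

theorem abelianObjects_iff {Y : C} : abelianObjects C Y ↔ Comm₂ (𝟙 Y) (𝟙 Y) := by
  refine ⟨comm₂_id_of_abelian, fun h => ?_⟩
  obtain ⟨μ, hμ₁, hμ₂⟩ := exists_addition h
  -- The shear (x, y) ↦ (x + y, y) is invertible, and its inverse provides the subtraction `δ`. The
  -- Mal'tsev operation is then (x − y) + z.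
  let σ : Y ⨯ Y ⟶ Y ⨯ Y := prod.lift μ prod.snd
  have h₁ : prod.lift (𝟙 Y) 0 ≫ σ = prod.lift (𝟙 Y) 0 := by ext <;> simp [σ, hμ₁]
  have h₂ : prod.lift 0 (𝟙 Y) ≫ σ = prod.lift (𝟙 Y) (𝟙 Y) := by ext <;> simp [σ, hμ₂]
  have : Mono σ := by
    refine mono_of_kernel_trivial σ fun S w hw => ?_
    have hs : w ≫ prod.snd = 0 := by simpa [σ] using hw =≫ prod.snd
    have hw' : w = (w ≫ prod.fst) ≫ prod.lift (𝟙 Y) 0 := by ext <;> simp [hs]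
    rw [hw', Category.assoc, h₁] at hw
    rw [hw', hw]
  have : StrongEpi σ := by
    refine strongEpi_of_extremal σ fun Z p m _ hm => ?_
    refine exists_section_of_idempotent m (e := prod.snd ≫ prod.lift (𝟙 Y) (𝟙 Y)) (by simp)
      ⟨prod.snd ≫ prod.lift 0 (𝟙 Y) ≫ p, by rw [Category.assoc, Category.assoc, hm, h₂]⟩
      fun S w hw => ⟨(w ≫ prod.fst) ≫ prod.lift (𝟙 Y) 0 ≫ p, ?_⟩
    have hs : w ≫ prod.snd = 0 := by simpa using hw =≫ prod.snd
    simp only [Category.assoc]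
    rw [hm, h₁]
    ext <;> simp [hs]
  have : IsIso σ := isIso_of_mono_of_strongEpi σ
  let δ : Y ⨯ Y ⟶ Y := inv σ ≫ prod.fst
  have hδ : σ ≫ δ = prod.fst := by simp [δ]
  have hδ₁ : prod.lift (𝟙 Y) (𝟙 Y) ≫ δ = 0 := by rw [← h₂, Category.assoc, hδ]; simp
  have hδ₂ : prod.lift δ prod.snd ≫ μ = prod.fst := by
    have : σ ≫ prod.lift δ prod.snd = 𝟙 _ := by ext <;> simp [hδ, σ]
    rw [← cancel_epi σ, reassoc_of% this]
    simp [σ]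
  refine ⟨prod.lift (prod.fst ≫ δ) prod.snd ≫ μ, ?_, ?_⟩
  · have e₁ : prod.lift (prod.fst : Y ⨯ Y ⟶ Y) prod.fst = prod.fst ≫ prod.lift (𝟙 Y) (𝟙 Y) := by
      simp
    have e₂ : prod.lift (0 : Y ⨯ Y ⟶ Y) (prod.snd : Y ⨯ Y ⟶ Y) =
        prod.snd ≫ prod.lift 0 (𝟙 Y) := by
      simp
    rw [prod.comp_lift_assoc, prod.lift_fst_assoc, prod.lift_snd, e₁, Category.assoc, hδ₁,
      comp_zero, e₂, Category.assoc, hμ₂, Category.comp_id]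
  · rw [prod.comp_lift_assoc, prod.lift_fst_assoc, prod.lift_snd, prod.lift_fst_snd,
      Category.id_comp, hδ₂]

end

/-! ### Commutator quotients and central extensions. -/

section

variable {C : Type u} [Category.{v} C] [HasZeroMorphisms C] [SemiAbelian C]

/-- The quotient of `X` by the commutator of `l` and `𝟙 X`. -/
theorem exists_commutator_quotient {L X : C} (l : L ⟶ X) :
    ∃ (Q : C) (q : X ⟶ Q), StrongEpi q ∧ Comm₂ (l ≫ q) q ∧ ∀ ⦃S : C⦄ (w : S ⟶ X), w ≫ q = 0 →
      ∃ (S' : C) (e : S' ⟶ S) (u : S' ⟶ L ⨿ X), StrongEpi e ∧ IsCross₂ u ∧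
        u ≫ coprod.desc l (𝟙 X) = e ≫ w := by
  let κ : L ⨿ X ⟶ L ⨯ X := prod.lift (coprod.desc (𝟙 L) 0) (coprod.desc 0 (𝟙 X))
  have : StrongEpi (coprod.desc l (𝟙 X)) :=
    strongEpi_of_local_section (e := 𝟙 X) (x := coprod.inr) (by simp)
  -- The cross elements form the kernel of `κ`, so their image under a strong epimorphism is normal.
  -- Thus the kernel of `q` is the commutator itself, with no normal closure to take.
  obtain ⟨Q, q, hq, haq, h⟩ :=
    ((hasNormalImage_kernel κ).comp (coprod.desc l (𝟙 X))).exists_cokernel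
  refine ⟨Q, q, hq, fun S w hw => ?_, fun S w hw => ?_⟩
  · have hwκ : w ≫ κ = 0 := by ext <;> simp [κ, hw.left, hw.right]
    have hd : coprod.desc (l ≫ q) q = coprod.desc l (𝟙 X) ≫ q := by simp
    rw [hd, ← kernel.lift_ι κ w hwκ, Category.assoc, ← Category.assoc (kernel.ι κ), haq, comp_zero]
  · obtain ⟨S', e, v, he, hv⟩ := h w hw
    have hκ := v ≫= kernel.condition κ
    exact ⟨S', e, v ≫ kernel.ι κ, he, ⟨by simpa [κ] using hκ =≫ prod.fst,
      by simpa [κ] using hκ =≫ prod.snd⟩, by simpa using hv⟩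

theorem isPullback_of_quotients {A B QA QB : C} {f : A ⟶ B} {qA : A ⟶ QA} {qB : B ⟶ QB}
    {f' : QA ⟶ QB} [StrongEpi qA] (w : f ≫ qB = qA ≫ f')
    (h₁ : ∀ ⦃S : C⦄ (s : S ⟶ A), s ≫ f = 0 → s ≫ qA = 0 → s = 0)
    (h₂ : ∀ ⦃S : C⦄ (y : S ⟶ B), y ≫ qB = 0 → ∃ (S' : C) (e : S' ⟶ S) (x : S' ⟶ A),
      StrongEpi e ∧ x ≫ qA = 0 ∧ x ≫ f = e ≫ y) : IsPullback f qA qB f' := by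
  have := strongEpi_pullback_lift w.symm h₂
  have : Mono (pullback.lift qA f w.symm) := mono_of_kernel_trivial _ fun S s hs =>
    h₁ s (by simpa using hs =≫ pullback.snd _ _) (by simpa using hs =≫ pullback.fst _ _)
  have : IsIso (pullback.lift qA f w.symm) := isIso_of_mono_of_strongEpi _
  exact (IsPullback.of_iso_pullback ⟨w.symm⟩ (asIso (pullback.lift qA f w.symm))
    (by simp) (by simp)).flip

theorem strongEpi_coprod_desc_of_split {K T G : C} (k : K ⟶ T) (p : T ⟶ G) (s : G ⟶ T)
    (hs : s ≫ p = 𝟙 G) (h : ∀ ⦃S : C⦄ (w : S ⟶ T), w ≫ p = 0 → ∃ w', w' ≫ k = w) :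
    StrongEpi (coprod.desc k s) := by
  refine strongEpi_coprod_desc ?_
  rintro Z m _ ⟨a, ha⟩ ⟨b, hb⟩
  refine exists_section_of_idempotent m (e := p ≫ s) (by simp [reassoc_of% hs])
    ⟨p ≫ b, by simp [hb]⟩ fun S w hw => ?_
  obtain ⟨w', hw'⟩ := h w (by simpa [hs] using hw =≫ p)
  exact ⟨w' ≫ a, by rw [Category.assoc, ha, hw']⟩

/-- If `L₁ ≤ R` is generated by `A × 0` and the diagonal of `L`, then under the given commutator
conditions `[L₁, R]` is contained in the diagonal of the kernel pair `R` of `c`. -/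
theorem cross_comp_eq_of_isKernelPair {X E R A L L₁ S : C} {c : X ⟶ E} {π₁ π₂ : R ⟶ X}
    (hR : IsKernelPair c π₁ π₂) {a : A ⟶ X} {l : L ⟶ X} {l₁ : L₁ ⟶ R} (σ : A ⨿ L ⟶ L₁)
    [StrongEpi σ] (hσ₁ : σ ≫ l₁ ≫ π₁ = coprod.desc a l) (hσ₂ : σ ≫ l₁ ≫ π₂ = coprod.desc 0 l)
    (ha : Comm₂ a (𝟙 X)) (hl : Comm₂ l (kernel.ι c)) (hlk : Comm₃ l (kernel.ι c) (𝟙 X))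
    {u : S ⟶ L₁ ⨿ R} (hu : IsCross₂ u) :
    u ≫ coprod.desc l₁ (𝟙 R) ≫ π₁ = u ≫ coprod.desc l₁ (𝟙 R) ≫ π₂ := by
  let k : kernel c ⟶ R := hR.lift (kernel.ι c) 0 (by simp)
  let s : X ⟶ R := hR.lift (𝟙 X) (𝟙 X) rfl
  have hk₁ : k ≫ π₁ = kernel.ι c := hR.lift_fst _ _ _
  have hk₂ : k ≫ π₂ = 0 := hR.lift_snd _ _ _
  have hs₁ : s ≫ π₁ = 𝟙 X := hR.lift_fst _ _ _
  have hs₂ : s ≫ π₂ = 𝟙 X := hR.lift_snd _ _ _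
  -- `R` is generated by K × 0, the kernel of `π₂`, and the diagonal.
  have : StrongEpi (coprod.desc k s) := by
    refine strongEpi_coprod_desc_of_split k π₂ s hs₂ fun T w hw => ?_
    have h₀ : (w ≫ π₁) ≫ c = 0 := by rw [Category.assoc, hR.w, reassoc_of% hw, zero_comp]
    exact ⟨kernel.lift c (w ≫ π₁) h₀, hR.hom_ext (by simp [hk₁]) (by simp [hk₂, hw])⟩
  obtain ⟨S', e, w, _, hw, he⟩ := hu.exists_local_lift σ (coprod.desc k s)
  have key := hw.desc_desc_eq ha hl hlk
  have h₁ : coprod.map σ (coprod.desc k s) ≫ coprod.desc l₁ (𝟙 R) ≫ π₁ =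
      coprod.desc (coprod.desc a l) (coprod.desc (kernel.ι c) (𝟙 X)) := by
    simp [hσ₁, hk₁, hs₁]
  have h₂ : coprod.map σ (coprod.desc k s) ≫ coprod.desc l₁ (𝟙 R) ≫ π₂ =
      coprod.desc (coprod.desc 0 l) (coprod.desc 0 (𝟙 X)) := by
    simp [hσ₂, hk₂, hs₂]
  rw [← cancel_epi e, ← reassoc_of% he, ← reassoc_of% he, h₁, h₂, key]

theorem exists_abelian_reflection (A : C) :
    ∃ (Q : C) (q : A ⟶ Q), StrongEpi q ∧ IsReflectionInto (abelianObjects C) q ∧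
      ∀ ⦃S : C⦄ (w : S ⟶ A), w ≫ q = 0 →
        ∃ (S' : C) (e : S' ⟶ S) (u : S' ⟶ A ⨿ A), StrongEpi e ∧ IsCross₂ u ∧
          u ≫ coprod.desc (𝟙 A) (𝟙 A) = e ≫ w := by
  obtain ⟨Q, q, _, hq, h⟩ := exists_commutator_quotient (𝟙 A)
  refine ⟨Q, q, inferInstance, ⟨abelianObjects_iff.2 ?_, fun Y hY f => ?_⟩, h⟩
  · refine Comm₂.of_strongEpi q q ?_
    simpa using hq
  · obtain ⟨k, hk⟩ := exists_desc q f fun S w hw => by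
      obtain ⟨S', e, u, _, hu, he⟩ := h w hw
      have hf := ((abelianObjects_iff.1 hY).precomp f f) u hu
      rw [← cancel_epi e, ← reassoc_of% he, comp_zero]
      simpa using hf
    exact ⟨k, hk, fun k' hk' => by rw [← cancel_epi q, hk', hk]⟩

/-- Elements of `[A, A]` vanish in a trivial extension as soon as they vanish in the codomain. -/
theorem eq_zero_of_isTrivialExtension {A B S : C} {f : A ⟶ B}
    (h : IsTrivialExtension (MorphismProperty.regularEpi C) (abelianObjects C) f)
    {u : S ⟶ A ⨿ A} (hu : IsCross₂ u) (hf : u ≫ coprod.desc f f = 0) :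
    u ≫ coprod.desc (𝟙 A) (𝟙 A) = 0 := by
  obtain ⟨_, A', B', ηA, ηB, f', hA, -, hp⟩ := h
  refine hp.hom_ext ?_ ?_
  · simpa using hf
  · simpa using ((abelianObjects_iff.1 hA.1).precomp ηA ηA) u hu

/-- If the pullback of `f` is trivial, the kernel of `f` embeds in it with zero image below, so its
commutators vanish. Conversely, the kernel pair of `f` splits it: `cross_comp_eq_of_isKernelPair`
puts the commutator of the kernel pair with itself inside the diagonal. -/
theorem isCentralExtension_iff {A B : C} (f : A ⟶ B) :
    IsCentralExtension (MorphismProperty.regularEpi C) (abelianObjects C) f ↔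
      IsRegularEpi f ∧ Comm₂ (kernel.ι f) (𝟙 A) := by
  constructor
  · rintro ⟨hf, P, B₁, q, f₁, p, hp, hP, ht⟩
    refine ⟨hf, ?_⟩
    have hp' : IsRegularEpi p := hp
    have := strongEpi_of_isPullback hP.flip
    let k : kernel f ⟶ P := hP.lift (kernel.ι f) 0 (by simp)
    have hk₁ : k ≫ q = kernel.ι f := hP.lift_fst _ _ _
    have hk₂ : k ≫ f₁ = 0 := hP.lift_snd _ _ _
    refine Comm₂.of_strongEpi (𝟙 _) q fun S w hw => ?_
    have := eq_zero_of_isTrivialExtension ht (hw.map k (𝟙 P)) (by simpa [hk₂] using hw.desc_zero_left f₁)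
    simpa [hk₁] using this =≫ q
  · rintro ⟨hf, h⟩
    refine ⟨hf, _, _, pullback.fst f f, pullback.snd f f, f, hf, IsPullback.of_hasPullback f f, ?_⟩
    have hR : IsKernelPair f _ _ := IsPullback.of_hasPullback f f
    let s : A ⟶ pullback f f := pullback.lift (𝟙 A) (𝟙 A) rfl
    let k : kernel f ⟶ pullback f f := pullback.lift (kernel.ι f) 0 (by simp)
    have : IsSplitEpi (pullback.snd f f) := ⟨⟨s, by simp [s]⟩⟩
    have : StrongEpi (coprod.desc k s) :=
      strongEpi_coprod_desc_of_split k (pullback.snd f f) s (by simp [s]) fun T w hw =>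
        ⟨kernel.lift f (w ≫ pullback.fst f f) (by
          rw [Category.assoc, pullback.condition, reassoc_of% hw, zero_comp]), by
          ext <;> simp [k, hw]⟩
    obtain ⟨QA, qA, _, hA, hkA⟩ := exists_abelian_reflection A
    obtain ⟨QR, qR, _, hR', hkR⟩ := exists_abelian_reflection (pullback f f)
    obtain ⟨f', hf', -⟩ := hR'.2 hA.1 (pullback.snd f f ≫ qA)
    refine ⟨inferInstanceAs (IsRegularEpi (pullback.snd f f)), QR, QA, qR, qA, f', hR', hA,
      isPullback_of_quotients hf'.symm (fun S w hw₁ hw₂ => ?_) fun S y hy => ?_⟩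
    · obtain ⟨S', e, u, _, hu, he⟩ := hkR w hw₂
      have key := cross_comp_eq_of_isKernelPair hR (l₁ := 𝟙 _) (coprod.desc k s)
        (a := kernel.ι f) (l := 𝟙 A) (by simp [k, s]) (by simp [k, s]) h h.symm
        (by simpa using comm₃_of_comm₂ (𝟙 A) h) hu
      rw [reassoc_of% he, reassoc_of% he, cancel_epi, hw₁] at key
      ext
      · simpa using key
      · simpa using hw₁
    · obtain ⟨S', e, u, _, hu, he⟩ := hkA y hy
      have hs : s ≫ pullback.snd f f = 𝟙 A := by simp [s]
      refine ⟨S', e, u ≫ coprod.map s s ≫ coprod.desc (𝟙 _) (𝟙 _), inferInstance, ?_, ?_⟩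
      · simpa using ((abelianObjects_iff.1 hR'.1).precomp (s ≫ qR) (s ≫ qR)) u hu
      · simpa [hs] using he

end

/-! ### The category of extensions, double extensions and the reflection into central extensions. -/

section

variable {C : Type u} [Category.{v} C]

section ExtensionCat

/-- A morphism of extensions given by a commutative square. -/
abbrev extHom {a b : ExtensionCat C} (l : a.obj.left ⟶ b.obj.left) (r : a.obj.right ⟶ b.obj.right)
    (w : l ≫ b.obj.hom = a.obj.hom ≫ r) : a ⟶ b :=
  ObjectProperty.homMk (Arrow.homMk l r w)

theorem extHom_w {a b : ExtensionCat C} (φ : a ⟶ b) :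
    φ.hom.left ≫ b.obj.hom = a.obj.hom ≫ φ.hom.right :=
  Arrow.w φ.hom

theorem extHom_ext {a b : ExtensionCat C} {φ ψ : a ⟶ b} (hl : φ.hom.left = ψ.hom.left)
    (hr : φ.hom.right = ψ.hom.right) : φ = ψ :=
  ObjectProperty.hom_ext _ (Arrow.hom_ext _ _ hl hr)

theorem extHom_ext_left {a b : ExtensionCat C} {φ ψ : a ⟶ b} (h : φ.hom.left = ψ.hom.left) :
    φ = ψ := by
  have := a.property
  refine extHom_ext h ?_
  rw [← cancel_epi a.obj.hom, ← extHom_w, ← extHom_w, h]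

theorem left_comp {a b c : ExtensionCat C} (φ : a ⟶ b) (ψ : b ⟶ c) :
    (φ ≫ ψ).hom.left = φ.hom.left ≫ ψ.hom.left := rfl

theorem right_comp {a b c : ExtensionCat C} (φ : a ⟶ b) (ψ : b ⟶ c) :
    (φ ≫ ψ).hom.right = φ.hom.right ≫ ψ.hom.right := rfl

theorem isPullback_of_left_right {a b c d : ExtensionCat C} {q : a ⟶ b} {f₁ : a ⟶ c} {f : b ⟶ d}
    {p : c ⟶ d} (hl : IsPullback q.hom.left f₁.hom.left f.hom.left p.hom.left)
    (hr : IsPullback q.hom.right f₁.hom.right f.hom.right p.hom.right) : IsPullback q f₁ f p := by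
  refine ⟨⟨extHom_ext hl.w hr.w⟩, ⟨PullbackCone.IsLimit.mk _
    (fun s => extHom (hl.lift s.fst.hom.left s.snd.hom.left ?_)
      (hr.lift s.fst.hom.right s.snd.hom.right ?_) ?_) ?_ ?_ ?_⟩⟩
  · rw [← left_comp, s.condition, left_comp]
  · rw [← right_comp, s.condition, right_comp]
  · apply hr.hom_ext
    · rw [Category.assoc, ← extHom_w, hl.lift_fst_assoc, Category.assoc, hr.lift_fst, extHom_w]
    · rw [Category.assoc, ← extHom_w, hl.lift_snd_assoc, Category.assoc, hr.lift_snd, extHom_w]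
  · exact fun s => extHom_ext (hl.lift_fst _ _ _) (hr.lift_fst _ _ _)
  · exact fun s => extHom_ext (hl.lift_snd _ _ _) (hr.lift_snd _ _ _)
  · intro s m h₁ h₂
    refine extHom_ext_left (hl.hom_ext ?_ ?_)
    · rw [← left_comp, h₁]
      exact (hl.lift_fst _ _ _).symm
    · rw [← left_comp, h₂]
      exact (hl.lift_snd _ _ _).symm

/-- An object viewed as an identity extension. -/
def idExt (S : C) : ExtensionCat C := ⟨Arrow.mk (𝟙 S), inferInstanceAs (IsRegularEpi (𝟙 S))⟩

/-- Morphisms from an identity extension are generalised elements of the domain. -/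
def idExtHom {S : C} {a : ExtensionCat C} (s : S ⟶ a.obj.left) : idExt S ⟶ a :=
  extHom (a := idExt S) s (s ≫ a.obj.hom) (Category.id_comp _).symm

/-- Identity extensions represent generalised elements of the domain, so taking domains preserves
pullbacks. -/
theorem isPullback_left {a b c d : ExtensionCat C} {q : a ⟶ b} {f₁ : a ⟶ c} {f : b ⟶ d}
    {p : c ⟶ d} (h : IsPullback q f₁ f p) :
    IsPullback q.hom.left f₁.hom.left f.hom.left p.hom.left := by
  have hw : ∀ s : PullbackCone f.hom.left p.hom.left,
      idExtHom s.fst ≫ f = idExtHom s.snd ≫ p := fun s => extHom_ext_left s.condition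
  refine ⟨⟨by rw [← left_comp, h.w, left_comp]⟩, ⟨PullbackCone.IsLimit.mk _
    (fun s => (h.lift (idExtHom s.fst) (idExtHom s.snd) (hw s)).hom.left) ?_ ?_ ?_⟩⟩
  · exact fun s => congrArg (fun χ => χ.hom.left) (h.lift_fst _ _ (hw s))
  · exact fun s => congrArg (fun χ => χ.hom.left) (h.lift_snd _ _ (hw s))
  · intro s m h₁ h₂
    have : idExtHom m = h.lift (idExtHom s.fst) (idExtHom s.snd) (hw s) := by
      apply h.hom_ext
      · rw [h.lift_fst]
        exact extHom_ext_left h₁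
      · rw [h.lift_snd]
        exact extHom_ext_left h₂
    rw [← this]
    rfl

end ExtensionCat

variable [HasZeroMorphisms C] [SemiAbelian C]

open scoped ZeroObject in
-- Morphisms out of S → 0 are elements of the kernel of an extension. Testing on them needs no
-- knowledge of the pullback on codomains.
theorem exists_kernel_lift {a b c d : ExtensionCat C} {q : a ⟶ b} {f₁ : a ⟶ c} {f : b ⟶ d}
    {p : c ⟶ d} (h : IsPullback q f₁ f p) {S : C} (x : S ⟶ b.obj.left) (y : S ⟶ c.obj.left)
    (hx : x ≫ b.obj.hom = 0) (hy : y ≫ c.obj.hom = 0) (w : x ≫ f.hom.left = y ≫ p.hom.left) :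
    ∃ t : S ⟶ a.obj.left, t ≫ q.hom.left = x ∧ t ≫ f₁.hom.left = y ∧ t ≫ a.obj.hom = 0 := by
  have : IsSplitEpi (0 : S ⟶ (0 : C)) := ⟨⟨0, by simp⟩⟩
  let z : ExtensionCat C := ⟨Arrow.mk (0 : S ⟶ (0 : C)), inferInstanceAs (IsRegularEpi 0)⟩
  let φ : z ⟶ b := extHom (a := z) x 0 (by rw [hx]; simp)
  let ψ : z ⟶ c := extHom (a := z) y 0 (by rw [hy]; simp)
  have hφψ : φ ≫ f = ψ ≫ p := extHom_ext_left w
  refine ⟨(h.lift φ ψ hφψ).hom.left, ?_, ?_, ?_⟩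
  · rw [← left_comp, h.lift_fst]
    rfl
  · rw [← left_comp, h.lift_snd]
    rfl
  · rw [extHom_w]
    change (0 : S ⟶ (0 : C)) ≫ _ = 0
    simp

theorem isPushout_of_kernel {X D E Z : C} {c : X ⟶ E} {d : X ⟶ D} {g : E ⟶ Z} {f : D ⟶ Z}
    (w : c ≫ g = d ≫ f) [Epi c] [StrongEpi f]
    (h : ∀ ⦃S : C⦄ (y : S ⟶ D), y ≫ f = 0 → ∃ (S' : C) (e : S' ⟶ S) (x : S' ⟶ X),
      StrongEpi e ∧ x ≫ c = 0 ∧ x ≫ d = e ≫ y) : IsPushout c d g f := by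
  have key : ∀ s : PushoutCocone c d, ∃ k : Z ⟶ s.pt, f ≫ k = s.inr := fun s =>
    exists_desc f s.inr fun S y hy => by
      obtain ⟨S', e, x, _, hx₁, hx₂⟩ := h y hy
      rw [← cancel_epi e, ← reassoc_of% hx₂, ← s.condition, reassoc_of% hx₁, zero_comp, comp_zero]
  refine ⟨⟨w⟩, ⟨PushoutCocone.IsColimit.mk _ (fun s => (key s).choose) ?_
    (fun s => (key s).choose_spec) fun s m _ hm => ?_⟩⟩
  · intro s
    rw [← cancel_epi c, reassoc_of% w, (key s).choose_spec, s.condition]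
  · rw [← cancel_epi f, hm, (key s).choose_spec]

/-- The image of the kernel of `c` under `d` is normal. The quotient by it factors through the
pushout, so it kills the kernel of `f`. -/
theorem exists_local_lift_of_isPushout {X D E Z : C} {c : X ⟶ E} {d : X ⟶ D} {g : E ⟶ Z}
    {f : D ⟶ Z} (h : IsPushout c d g f) [StrongEpi c] [StrongEpi d] {S : C} (y : S ⟶ D)
    (hy : y ≫ f = 0) :
    ∃ (S' : C) (e : S' ⟶ S) (x : S' ⟶ X), StrongEpi e ∧ x ≫ c = 0 ∧ x ≫ d = e ≫ y := by
  obtain ⟨Q, q, _, hq, hk⟩ := ((hasNormalImage_kernel c).comp d).exists_cokernel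
  obtain ⟨r, hr⟩ := exists_desc c (d ≫ q) fun T w hw => by
    rw [← kernel.lift_ι c w hw, Category.assoc]
    simp only [Category.assoc] at hq
    rw [hq, comp_zero]
  have hyq : y ≫ q = 0 := by
    rw [← h.inr_desc r q hr, reassoc_of% hy, zero_comp]
  obtain ⟨S', e, v, he, hv⟩ := hk y hyq
  exact ⟨S', e, v ≫ kernel.ι c, he, by simp, by simpa using hv⟩

theorem exists_central_reflection (a : ExtensionCat C) :
    ∃ (a' : ExtensionCat C) (η : a ⟶ a'), StrongEpi η.hom.left ∧ IsIso η.hom.right ∧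
      IsReflectionInto (centralExtensions C) η ∧
      Comm₂ (kernel.ι a.obj.hom ≫ η.hom.left) η.hom.left ∧
      ∀ ⦃S : C⦄ (w : S ⟶ a.obj.left), w ≫ η.hom.left = 0 →
        ∃ (S' : C) (e : S' ⟶ S) (u : S' ⟶ kernel a.obj.hom ⨿ a.obj.left), StrongEpi e ∧
          IsCross₂ u ∧ u ≫ coprod.desc (kernel.ι a.obj.hom) (𝟙 _) = e ≫ w := by
  have := a.property
  obtain ⟨Q, q, _, hq, h⟩ := exists_commutator_quotient (kernel.ι a.obj.hom)
  obtain ⟨y, hy⟩ := exists_desc q a.obj.hom fun S w hw => by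
    obtain ⟨S', e, u, _, hu, he⟩ := h w hw
    rw [← cancel_epi e, ← reassoc_of% he, comp_zero]
    simpa using hu.desc_zero_left a.obj.hom
  have : StrongEpi (q ≫ y) := by rw [hy]; infer_instance
  have : StrongEpi y := strongEpi_of_strongEpi q y
  have hyr : IsRegularEpi y := inferInstance
  let a' : ExtensionCat C := ⟨Arrow.mk y, hyr⟩
  let η : a ⟶ a' := extHom (b := a') q (𝟙 _) (hy.trans (Category.comp_id _).symm)
  refine ⟨a', η, inferInstanceAs (StrongEpi q), inferInstanceAs (IsIso (𝟙 _)), ⟨?_, ?_⟩, hq, h⟩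
  · refine (isCentralExtension_iff y).2 ⟨hyr, ?_⟩
    let κ : kernel a.obj.hom ⟶ kernel y := kernel.map _ _ q (𝟙 _) (by simp [hy])
    have : StrongEpi κ := by
      obtain ⟨S', e, x, _, hx⟩ := exists_local_lift q (kernel.ι y)
      refine strongEpi_of_local_section (e := e) (x := kernel.lift _ x ?_) ?_
      · rw [← hy, reassoc_of% hx, kernel.condition, comp_zero]
      · ext
        simpa [κ] using hx
    refine Comm₂.of_strongEpi κ q ?_
    simpa [κ] using hq
  · intro b hb φ
    have hb' := ((isCentralExtension_iff b.obj.hom).1 hb).2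
    obtain ⟨k, hk⟩ := exists_desc q φ.hom.left fun S w hw => by
      obtain ⟨S', e, u, _, hu, he⟩ := h w hw
      have := hb'.precomp (kernel.map a.obj.hom b.obj.hom _ _ (extHom_w φ).symm) φ.hom.left u hu
      rw [← cancel_epi e, ← reassoc_of% he, comp_zero]
      simpa using this
    refine ⟨extHom (a := a') k φ.hom.right ?_, extHom_ext_left hk, fun ψ hψ => extHom_ext_left ?_⟩
    · change k ≫ b.obj.hom = y ≫ φ.hom.right
      rw [← cancel_epi q, reassoc_of% hk, reassoc_of% hy, extHom_w]
    · rw [← cancel_epi q]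
      exact (congrArg (fun χ => χ.hom.left) hψ).trans hk.symm

/-- In a trivial double extension, elements of the commutator of the kernel of the domain vanish as
soon as they vanish in the codomain. -/
theorem eq_zero_of_isTrivialExtension_double {a b : ExtensionCat C} {f : a ⟶ b}
    (h : IsTrivialExtension (doubleExtensions C) (centralExtensions C) f) {L S : C}
    {l : L ⟶ a.obj.left} (hl : l ≫ a.obj.hom = 0) {u : S ⟶ L ⨿ a.obj.left} (hu : IsCross₂ u)
    (hf : u ≫ coprod.desc (l ≫ f.hom.left) f.hom.left = 0) :
    u ≫ coprod.desc l (𝟙 _) = 0 := by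
  obtain ⟨_, a', b', ηa, ηb, f', ha, -, hp⟩ := h
  have hη : u ≫ coprod.desc l (𝟙 _) ≫ ηa.hom.left = 0 := by
    have := (((isCentralExtension_iff a'.obj.hom).1 ha.1).2.precomp
      (kernel.lift a'.obj.hom (l ≫ ηa.hom.left)
        (by rw [Category.assoc, extHom_w, reassoc_of% hl, zero_comp])) ηa.hom.left) u hu
    simpa using this
  have hf' : u ≫ coprod.desc l (𝟙 _) ≫ f.hom.left = 0 := by simpa using hf
  have : idExtHom (u ≫ coprod.desc l (𝟙 _)) = idExtHom (0 : S ⟶ a.obj.left) := by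
    apply hp.hom_ext
    · refine extHom_ext_left ?_
      change (u ≫ coprod.desc l (𝟙 _)) ≫ f.hom.left = 0 ≫ f.hom.left
      rw [Category.assoc, hf', zero_comp]
    · refine extHom_ext_left ?_
      change (u ≫ coprod.desc l (𝟙 _)) ≫ ηa.hom.left = 0 ≫ ηa.hom.left
      rw [Category.assoc, hη, zero_comp]
  exact congrArg (fun χ => χ.hom.left) this

end

/-! ### The two implications and the passage to subobjects. -/

section

variable {C : Type u} [Category.{v} C] [HasZeroMorphisms C] [SemiAbelian C]
  {X C₀ D Z : C} {c : X ⟶ C₀} {d : X ⟶ D} {g : C₀ ⟶ Z} {f : D ⟶ Z}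

theorem comm_of_isCentral {h : IsDoubleExtension c d g f} (hc : h.IsCentral) :
    Comm₃ (kernel.ι c) (kernel.ι d) (𝟙 X) ∧ Comm₂ (kernel.ι c) (kernel.ι d) ∧
      Comm₂ (kernel.ι (prod.lift c d)) (𝟙 X) := by
  obtain ⟨-, a₁, b₁, q, f₁, p, hp, hP, ht⟩ := hc
  let P := a₁.obj.left
  let M := b₁.obj.left
  let q' : P ⟶ X := q.hom.left
  let p' : M ⟶ C₀ := p.hom.left
  have hP' : IsPullback q' f₁.hom.left c p' := isPullback_left hP
  have := b₁.property
  have hpr : IsRegularEpi p' := hp.regularEpi_c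
  have hq : StrongEpi q' := strongEpi_of_isPullback hP'.flip
  let k : kernel c ⟶ P := hP'.lift (kernel.ι c) 0 (by simp)
  have hk₁ : k ≫ q' = kernel.ι c := hP'.lift_fst _ _ _
  have hk₂ : k ≫ f₁.hom.left = 0 := hP'.lift_snd _ _ _
  let α : kernel b₁.obj.hom ⟶ C₀ := kernel.ι b₁.obj.hom ≫ p'
  -- This covers `L` by pairs of an element of `L` and a lift of its image under `c` to the kernel
  -- of `b₁`; `p` being a double extension supplies such lifts locally. `t` then sends each pair
  -- into the kernel of `a₁`.
  let π : pullback (kernel.ι d ≫ c) α ⟶ kernel d := pullback.fst _ _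
  have hπ : StrongEpi π := by
    obtain ⟨S, e, x, _, hx₁, hx₂⟩ := exists_local_lift_of_isPushout hp.isPushout.flip
      (kernel.ι d ≫ c) (by
        change (kernel.ι d ≫ c) ≫ g = 0
        rw [Category.assoc, h.isPushout.w, kernel.condition_assoc, zero_comp])
    refine strongEpi_of_local_section (e := e)
      (x := pullback.lift e (kernel.lift b₁.obj.hom x hx₁) ?_) (pullback.lift_fst _ _ _)
    exact hx₂.symm.trans (by simp [α, p'])
  obtain ⟨t, ht₁, ht₂, ht₃⟩ : ∃ t : pullback (kernel.ι d ≫ c) α ⟶ P, t ≫ q' = π ≫ kernel.ι d ∧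
      t ≫ f₁.hom.left = pullback.snd _ _ ≫ kernel.ι b₁.obj.hom ∧ t ≫ a₁.obj.hom = 0 := by
    refine exists_kernel_lift hP _ _ ?_ ?_ ?_
    · change (π ≫ kernel.ι d) ≫ d = 0
      simp
    · simp
    · change (π ≫ kernel.ι d) ≫ c = (_ ≫ _) ≫ p'
      rw [Category.assoc, pullback.condition, Category.assoc]
  refine ⟨?_, ?_, ?_⟩
  · refine Comm₃.of_strongEpi (𝟙 _) π q' fun S w hw => ?_
    -- Folding `K` into `P` gives a cross element of the lifted `L` with `P`; its image is 0 because
    -- `k` is killed below.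
    have key := eq_zero_of_isTrivialExtension_double ht ht₃ (hw.fold k) (by
      rw [Category.assoc]
      exact comp_eq_zero_of_factor hw.kill₁
        (coprod.desc (t ≫ f₁.hom.left) f₁.hom.left) (by ext <;> simp [hk₂]))
    have := key =≫ q'
    rw [zero_comp] at this
    rw [← this]
    simp only [Category.assoc]
    congr 1
    ext <;> simp [hk₁, ht₁]
  · refine Comm₂.of_strongEpi (𝟙 _) π fun S w hw => ?_
    have key := eq_zero_of_isTrivialExtension_double ht ht₃ (hw.swap.map (𝟙 _) k) (by
      rw [Category.assoc, Category.assoc]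
      exact comp_eq_zero_of_factor hw.right (t ≫ f₁.hom.left) (by ext <;> simp [hk₂]))
    have := key =≫ q'
    rw [zero_comp] at this
    rw [← this]
    simp only [Category.assoc]
    congr 1
    ext <;> simp [hk₁, ht₁]
  · have hc' : kernel.ι (prod.lift c d) ≫ c = 0 := by
      simpa using kernel.condition (prod.lift c d) =≫ prod.fst
    have hd' : kernel.ι (prod.lift c d) ≫ d = 0 := by
      simpa using kernel.condition (prod.lift c d) =≫ prod.snd
    obtain ⟨s, hs₁, hs₂, hs₃⟩ := exists_kernel_lift hP (kernel.ι (prod.lift c d)) 0 hd' zero_comp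
      (hc'.trans zero_comp.symm)
    refine Comm₂.of_strongEpi (𝟙 _) q' fun S w hw => ?_
    have key := eq_zero_of_isTrivialExtension_double ht hs₃ hw (by
      rw [hs₂]
      exact hw.desc_zero_left _)
    have hs₁' : s ≫ q' = kernel.ι (prod.lift c d) := hs₁
    have := key =≫ q'
    rw [zero_comp] at this
    rw [← this]
    simp only [Category.assoc]
    congr 1
    ext <;> simp [hs₁']

/-- Given a pair in the kernel pair of `f`, lift its first entry to `X`. The double extension then
provides a lift of the second entry with the same image under `c`. -/
theorem strongEpi_kernelPair_map (h : IsDoubleExtension c d g f) :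
    StrongEpi (pullback.map c c f f d d g h.isPushout.w h.isPushout.w) := by
  have := h.regularEpi_c
  have := h.regularEpi_d
  obtain ⟨S, e, x, _, hx⟩ := exists_local_lift d (pullback.fst f f)
  obtain ⟨S', e', x', _, hx₁, hx₂⟩ := exists_local_lift_of_square h.isPushout.w
    (fun S y hy => exists_local_lift_of_isPushout h.isPushout y hy) (x ≫ c)
    (e ≫ pullback.snd f f) (by
      rw [Category.assoc, h.isPushout.w, reassoc_of% hx, pullback.condition, Category.assoc])
  refine strongEpi_of_local_section (e := e' ≫ e)
    (x := pullback.lift (e' ≫ x) x' (by rw [hx₁, Category.assoc])) ?_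
  ext
  · simp [hx]
  · simp [hx₂]

theorem isDoubleExtension_kernelPair (h : IsDoubleExtension c d g f) :
    IsDoubleExtension (pullback.snd c c)
      (pullback.map c c f f d d g h.isPushout.w h.isPushout.w) d (pullback.snd f f) := by
  have := strongEpi_kernelPair_map h
  have := h.regularEpi_c
  have := h.regularEpi_d
  have : IsSplitEpi (pullback.snd c c) := ⟨⟨pullback.lift (𝟙 X) (𝟙 X) rfl, by simp⟩⟩
  have : IsSplitEpi (pullback.snd f f) := ⟨⟨pullback.lift (𝟙 D) (𝟙 D) rfl, by simp⟩⟩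
  refine ⟨isPushout_of_kernel (by simp) fun S y hy => ?_, inferInstance, inferInstance,
    h.regularEpi_d, inferInstance⟩
  obtain ⟨S', e, x, he, hx₁, hx₂⟩ := exists_local_lift_of_isPushout h.isPushout
    (y ≫ pullback.fst f f)
    (by rw [Category.assoc, pullback.condition, reassoc_of% hy, zero_comp])
  refine ⟨S', e, pullback.lift x 0 (by simp [hx₁]), he, by simp, ?_⟩
  ext
  · simp [hx₂]
  · simp [hy]

theorem isCentral_of_comm (h : IsDoubleExtension c d g f)
    (h₃ : Comm₃ (kernel.ι c) (kernel.ι d) (𝟙 X)) (h₂ : Comm₂ (kernel.ι c) (kernel.ι d))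
    (h₁ : Comm₂ (kernel.ι (prod.lift c d)) (𝟙 X)) : h.IsCentral := by
  have hdR := isDoubleExtension_kernelPair h
  let R := pullback c c
  let dR : R ⟶ pullback f f := pullback.map c c f f d d g h.isPushout.w h.isPushout.w
  let a : ExtensionCat C := ⟨Arrow.mk d, h.regularEpi_d⟩
  let r : ExtensionCat C := ⟨Arrow.mk dR, hdR.regularEpi_d⟩
  let π₁ : r ⟶ a := extHom (a := r) (b := a) (pullback.fst c c) (pullback.fst f f)
    (by simp [a, r, dR])
  let π₂ : r ⟶ a := extHom (a := r) (b := a) (pullback.snd c c) (pullback.snd f f)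
    (by simp [a, r, dR])
  have hR : IsKernelPair c (pullback.fst c c) (pullback.snd c c) := IsPullback.of_hasPullback c c
  have hpb : IsPullback π₁ π₂ h.toHom h.toHom :=
    isPullback_of_left_right hR (IsPullback.of_hasPullback f f)
  obtain ⟨r', ηr, hηr, hηr', hr, hrc, hrk⟩ := exists_central_reflection r
  obtain ⟨a', ηa, hηa, hηa', ha, -, hak⟩ := exists_central_reflection a
  obtain ⟨f', hf', -⟩ := hr.2 ha.1 (π₂ ≫ ηa)
  refine ⟨h, r, a, π₁, π₂, h.toHom, h, hpb, hdR, r', a', ηr, ηa, f', hr, ha, ?_⟩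
  have hw := congrArg (fun χ => χ.hom.left) hf'
  have hw' := congrArg (fun χ => χ.hom.right) hf'
  -- Both units are invertible on codomains, so only the square of domains matters.
  refine isPullback_of_left_right ?_ (IsPullback.of_vert_isIso ⟨hw'.symm⟩)
  let qr : R ⟶ r'.obj.left := ηr.hom.left
  let qa : X ⟶ a'.obj.left := ηa.hom.left
  have hsd : kernel.ι d ≫ pullback.lift (𝟙 X) (𝟙 X) rfl ≫ dR = 0 := by
    ext <;> simp [dR]
  let s : kernel d ⟶ kernel dR := kernel.lift dR (kernel.ι d ≫ pullback.lift (𝟙 X) (𝟙 X) rfl)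
    (by rw [Category.assoc, hsd])
  have hs₂ : s ≫ kernel.ι dR ≫ pullback.snd c c = kernel.ι d := by simp [s]
  have hcd : kernel.ι (prod.lift c d) ≫ c = 0 := by
    simpa using kernel.condition (prod.lift c d) =≫ prod.fst
  have hcd' : kernel.ι (prod.lift c d) ≫ d = 0 := by
    simpa using kernel.condition (prod.lift c d) =≫ prod.snd
  let k : kernel (prod.lift c d) ⟶ kernel dR :=
    kernel.lift dR (pullback.lift (kernel.ι (prod.lift c d)) 0 (by simp [hcd]))
      (by ext <;> simp [dR, hcd'])
  -- The kernel of `dR` is split over `L` by the second projection, with kernel (K∧L) × 0 and the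
  -- diagonal as section.
  have hσ : StrongEpi (coprod.desc k s) := by
    refine strongEpi_coprod_desc_of_split k
      (kernel.map dR d (pullback.snd c c) (pullback.snd f f) (by simp [dR])) s
      (by ext; simp [s]) fun S w hw => ?_
    have hw₂ : w ≫ kernel.ι dR ≫ pullback.snd c c = 0 := by simpa using hw =≫ kernel.ι d
    have hwc : w ≫ kernel.ι dR ≫ pullback.fst c c ≫ c = 0 := by
      rw [pullback.condition, reassoc_of% hw₂, zero_comp]
    have hwd : w ≫ kernel.ι dR ≫ pullback.fst c c ≫ d = 0 := by
      have h₀ : dR ≫ pullback.fst f f = pullback.fst c c ≫ d := by simp [dR]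
      rw [← h₀, kernel.condition_assoc, zero_comp, comp_zero]
    refine ⟨kernel.lift _ (w ≫ kernel.ι dR ≫ pullback.fst c c) ?_, ?_⟩
    · ext
      · simpa using hwc
      · simpa using hwd
    · ext <;> simp [k, hw₂]
  refine isPullback_of_quotients (qA := qr) (qB := qa) (f := pullback.snd c c) hw.symm
    (fun S w hw₁ hw₂ => ?_) fun S y hy => ?_
  · have hrk' : ∃ (S' : C) (e : S' ⟶ S) (u : S' ⟶ kernel dR ⨿ pullback c c), StrongEpi e ∧
        IsCross₂ u ∧ u ≫ coprod.desc (kernel.ι dR) (𝟙 (pullback c c)) = e ≫ w := hrk w hw₂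
    obtain ⟨S', e, u, _, hu, he⟩ := hrk'
    have key := cross_comp_eq_of_isKernelPair hR (l₁ := kernel.ι dR) (coprod.desc k s)
      (a := kernel.ι (prod.lift c d)) (l := kernel.ι d) (by ext <;> simp [k, s])
      (by ext <;> simp [k, s]) h₁ h₂.symm ?_ hu
    · rw [reassoc_of% he, reassoc_of% he, cancel_epi, hw₁] at key
      ext
      · simpa using key
      · simpa using hw₁
    · intro S w hw
      have : coprod.desc (coprod.desc (kernel.ι d) (kernel.ι c)) (𝟙 X) =
          coprod.map (coprod.desc coprod.inr coprod.inl) (𝟙 X) ≫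
            coprod.desc (coprod.desc (kernel.ι c) (kernel.ι d)) (𝟙 X) := by
        ext <;> simp
      rw [this, ← Category.assoc]
      refine h₃ _ ⟨?_, ?_, ?_⟩ <;> rw [Category.assoc]
      · exact comp_eq_zero_of_factor hw.kill₂ (𝟙 _) (by ext <;> simp)
      · exact comp_eq_zero_of_factor hw.kill₁ (𝟙 _) (by ext <;> simp)
      · exact comp_eq_zero_of_factor hw.kill₃ (coprod.desc coprod.inr coprod.inl)
          (by ext <;> simp)
  -- An element of [L,X] lifts along the diagonal to an element of [L₁,R], which `ηr` kills.
  · obtain ⟨S', e, u, he, hu, hu'⟩ := hak y hy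
    let Δ : X ⟶ R := pullback.lift (𝟙 X) (𝟙 X) rfl
    have hu'' : u ≫ coprod.desc (kernel.ι d) (𝟙 X) = e ≫ y := hu'
    refine ⟨S', e, u ≫ coprod.map s Δ ≫ coprod.desc (kernel.ι dR) (𝟙 R), he, ?_, ?_⟩
    · have : u ≫ coprod.desc (s ≫ kernel.ι dR ≫ qr) (Δ ≫ qr) = 0 := (hrc.precomp s Δ) u hu
      simpa using this
    · rw [← hu'']
      simp [hs₂, Δ]

theorem comm₂_congr {A B A' B' Y : C} {x : A ⟶ Y} {y : B ⟶ Y} {x' : A' ⟶ Y} {y' : B' ⟶ Y}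
    (a : A ≅ A') (b : B ≅ B') (ha : a.hom ≫ x' = x) (hb : b.hom ≫ y' = y) :
    Comm₂ x y ↔ Comm₂ x' y' := by
  subst ha hb
  exact ⟨fun h => by simpa using h.precomp a.inv b.inv, fun h => h.precomp a.hom b.hom⟩

theorem comm₃_congr {A B E A' B' E' Y : C} {x : A ⟶ Y} {y : B ⟶ Y} {z : E ⟶ Y} {x' : A' ⟶ Y}
    {y' : B' ⟶ Y} {z' : E' ⟶ Y} (a : A ≅ A') (b : B ≅ B') (e : E ≅ E') (ha : a.hom ≫ x' = x)
    (hb : b.hom ≫ y' = y) (he : e.hom ≫ z' = z) : Comm₃ x y z ↔ Comm₃ x' y' z' := by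
  subst ha hb he
  exact ⟨fun h => by simpa using h.precomp a.inv b.inv e.inv, fun h => h.precomp a.hom b.hom e.hom⟩

theorem exists_iso_kernel_prod_lift (c : X ⟶ C₀) (d : X ⟶ D) :
    ∃ i : ((kernelSubobject c ⊓ kernelSubobject d : Subobject X) : C) ≅ kernel (prod.lift c d),
      i.hom ≫ kernel.ι (prod.lift c d) = (kernelSubobject c ⊓ kernelSubobject d).arrow := by
  have hc : (kernelSubobject c ⊓ kernelSubobject d).arrow ≫ c = 0 := by
    rw [← Subobject.ofLE_arrow (inf_le_left : kernelSubobject c ⊓ kernelSubobject d ≤ _),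
      Category.assoc, kernelSubobject_arrow_comp, comp_zero]
  have hd : (kernelSubobject c ⊓ kernelSubobject d).arrow ≫ d = 0 := by
    rw [← Subobject.ofLE_arrow (inf_le_right : kernelSubobject c ⊓ kernelSubobject d ≤ _),
      Category.assoc, kernelSubobject_arrow_comp, comp_zero]
  have hcd : kernel.ι (prod.lift c d) ≫ c = 0 := by
    simpa using kernel.condition (prod.lift c d) =≫ prod.fst
  have hcd' : kernel.ι (prod.lift c d) ≫ d = 0 := by
    simpa using kernel.condition (prod.lift c d) =≫ prod.snd
  have hfac : (kernelSubobject c ⊓ kernelSubobject d).Factors (kernel.ι (prod.lift c d)) :=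
    (Subobject.inf_factors _).2
      ⟨kernelSubobject_factors c _ hcd, kernelSubobject_factors d _ hcd'⟩
  refine ⟨⟨kernel.lift _ (kernelSubobject c ⊓ kernelSubobject d).arrow (by ext <;> simp [hc, hd]),
    Subobject.factorThru _ _ hfac, ?_, ?_⟩, by simp⟩
  · rw [← cancel_mono (kernelSubobject c ⊓ kernelSubobject d).arrow]
    simp
  · ext
    simp

end

end SemiAbelian

theorem proposition4p14 {C : Type u} [Category.{v} C] [HasZeroMorphisms C] [SemiAbelian C]
    {X C₀ D Z : C} {c : X ⟶ C₀} {d : X ⟶ D} {g : C₀ ⟶ Z} {f : D ⟶ Z}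
    (h : IsDoubleExtension c d g f) :
    h.IsCentral ↔
      commutatorSubobject ![kernelSubobject c, kernelSubobject d, ⊤] = ⊥ ∧
      commutatorSubobject ![kernelSubobject c, kernelSubobject d] = ⊥ ∧
      commutatorSubobject ![kernelSubobject c ⊓ kernelSubobject d, ⊤] = ⊥ := by
  obtain ⟨i, hi⟩ := SemiAbelian.exists_iso_kernel_prod_lift c d
  have hc := kernelSubobject_arrow c
  have hd := kernelSubobject_arrow d
  have ht : (asIso (⊤ : Subobject X).arrow).hom ≫ 𝟙 X = (⊤ : Subobject X).arrow := by simp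
  rw [SemiAbelian.commutatorSubobject_triple_eq_bot_iff,
    SemiAbelian.commutatorSubobject_pair_eq_bot_iff,
    SemiAbelian.commutatorSubobject_pair_eq_bot_iff,
    SemiAbelian.comm₃_congr (kernelSubobjectIso c) (kernelSubobjectIso d) (asIso _) hc hd ht,
    SemiAbelian.comm₂_congr (kernelSubobjectIso c) (kernelSubobjectIso d) hc hd,
    SemiAbelian.comm₂_congr i (asIso _) hi ht]
  exact ⟨SemiAbelian.comm_of_isCentral, fun ⟨h₃, h₂, h₁⟩ =>
    SemiAbelian.isCentral_of_comm h h₃ h₂ h₁⟩
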